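/- **Theorem 1.** Let $p$ be a prime and $n\ge 2$. Let $L=\mathbb{Z}_p\mathbf h\oplus\mathbb{Z}_p\mathbf v$ be the group of loops on the torus, $(a_1\mathbf h+a_2\mathbf v)\times(b_1\mathbf h+b_2\mathbf v)=a_1b_2-a_2b_1$, $\zeta_p=e^{2\pi i/p}$, $\delta(\mathbf s)=1$ if $\mathbf s=0$ and $0$ otherwise. On $\mathbb{C}^{L}$ with basis $|\mathbf t\rangle$ let $X^{\mathbf s}|\mathbf t\rangle=|\mathbf s+\mathbf t\rangle$ and $Z^{\mathbf s}|\mathbf t\rangle=\zeta_p^{\mathbf s\times\mathbf t}|\mathbf t\rangle$. *Data.* A finite set of syndromes $\theta$ with probabilities $\Pr(\theta)>0$, $\sum_\theta\Pr(\theta)=1$, and for each $\theta$ a matrix $Q(\theta)=(Q_{\mathbf i,\mathbf s;\mathbf j,\mathbf t}(\theta))$ with rows indexed by $(\mathbf i,\mathbf s)\in L^2$ and columns by $(\mathbf j,\mathbf t)\in L^2$, which is Hermitian and positive semidefinite, and whose blocks $(q_{\mathbf s,\mathbf t})_{\mathbf i,\mathbf j}=Q_{\mathbf i,\mathbf s;\mathbf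 j,\mathbf t}$ satisfy $\operatorname{tr}q_{\mathbf s,\mathbf t}(\theta)=\delta(\mathbf s-\mathbf t)$. Thus $Q(\theta)[\rho]=\sum_{\mathbf s,\mathbf t}\rho_{\mathbf s,\mathbf t}\,q_{\mathbf s,\mathbf t}(\theta)$ is a quantum channel on $\mathbb{C}^L$. The $X$-loop expectation tensor of the data is $$\langle \hat X_1^{\mathbf t_1}\cdots\hat X_{2n}^{\mathbf t_{2n}}\rangle=\frac{\sum_\theta\Pr(\theta)^n\operatorname{tr}\bigl(q_{\mathbf t_1,-\mathbf t_2}\,q_{\mathbf t_3,-\mathbf t_4}\cdots q_{\mathbf t_{2n-1},-\mathbf t_{2n}}\bigr)}{\sum_\theta\Pr(\theta)^n\operatorname{tr}\bigl(q_{00}^{\,n}\bigr)},\qquad \mathbf t_1,\dots,\mathbf t_{2n}\in L .$$ *SPT form.* An SPT order is a pair $(G,\chi)$ of a subgroup $G\subseteq\mathbb{Z}_p^{2n}=\langle x_1,\dots,x_{2n}\rangle$ and an alternating bimultiplicative function $\chi:G\times G\to\mathbb{C}^*$. Its tensor takes, at $\mathbf t_k=a_k\mathbf h+b_k\mathbf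 v$ and with $a=\prod_k x_k^{a_k}$, $b=\prod_k x_k^{b_k}$, the value $\chi(a,b)$ if $a,b\in G$, and $0$ otherwise. A *solution* consists of data and an SPT order such that the $X$-loop expectation tensor of the data equals the tensor of the SPT order. *Claim.* Exactly $p+3$ SPT orders occur in solutions, and each solution belongs to exactly one of the following $p+3$ classes (indices of layers are cyclic modulo $2n$). | class | generators of $G$ | $X$-loop expectation tensor | $\chi$ | |---|---|---|---| | Case 1 | $x_{2i-1}x_{2i}^{-1}$ | $\prod_{i=1}^n\delta(\mathbf t_{2i-1}+\mathbf t_{2i})$ | $1$ | | Case 2 | $x_1x_2^{-1}\cdots x_{2n-1}x_{2n}^{-1}$ | $\prod_{k=1}^{2n}\delta(\mathbf t_k+\mathbf t_{k+1})$ | $1$ | | Case 3a | $x_1x_i^{-1}$ | $\delta(\mathbf t_1+\dots+\mathbf t_{2n})$ | $1$ | | Case 3b, $c=1,\dots,p-1$ | $x_1x_i^{-1}$ | $\delta(\mathbf t_1+\dots+\mathbf t_{2n})\prod_{i<j}\zeta_p^{c\,\mathbf t_i\times\mathbf t_j}$ | $\zeta_p^{\,c\sum_{i<j}(a_ib_j-a_jb_i)}$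 | | Case 4 | $x_{2i}x_{2i+1}^{-1}$ | $\prod_{i=1}^n\delta(\mathbf t_{2i}+\mathbf t_{2i+1})$ | $1$ | Consider the following forms of a channel $Q(\theta)$, where $U_\theta$ is a unitary: * Case 1 (complete erasure): $Q(\theta)[\rho]=\operatorname{tr}(\rho)\,q_{00}(\theta)$; * Case 2 ($Z$-dephasing): $Q(\theta)[\rho]=U_\theta\bigl(p^{-2}\sum_{\mathbf s}Z^{\mathbf s}\rho Z^{-\mathbf s}\bigr)U_\theta^\dagger$; * Case 3a ($X$-dephasing): $Q(\theta)[\rho]=U_\theta\bigl(p^{-2}\sum_{\mathbf s}X^{\mathbf s}\rho X^{-\mathbf s}\bigr)U_\theta^\dagger$; * Case 3b ($XZ^{-c}$-dephasing): $Q(\theta)[\rho]=U_\theta\,N_c[\rho]\,U_\theta^\dagger$ with $N_c[\rho]=p^{-2}\sum_{\mathbf s}X^{\mathbf s}Z^{-c\mathbf s}\rho Z^{c\mathbf s}X^{-\mathbf s}$; * Case 4 (unitary): $Q(\theta)[\rho]=U_\theta\,\rho\,U_\theta^\dagger$. In each class, channels of the corresponding form exist, and all data whose channels $Q(\theta)$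 all have this form have the expectation tensor of the class. Conversely, if data have the expectation tensor of Case 1, 2, 3a or 4, then every $Q(\theta)$ has the corresponding form. If they have that of Case 3b with parameter $c$, then for every $\theta$ the effective channel of $Q(\theta)$ under optimal recovery is $N_c$: there are quantum channels $R_\theta$ and $S_\theta$ on $\mathbb{C}^L$ such that $R_\theta\circ Q(\theta)=N_c$ and $S_\theta\circ N_c=Q(\theta)$. -/

import Mathlib

open scoped Matrix ComplexOrder BigOperators

universe u

noncomputable section

namespace ToricCode

/-! ### Loops on the torus and logical Wilson loop operators -/

/-- Loops `a h + b v` on the torus: `H₁(T²; ℤ/p) = ℤ/p h ⊕ ℤ/p v`, written as pairs `(a, b)`. -/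
abbrev Loop (p : ℕ) : Type := ZMod p × ZMod p

/-- The intersection product `(a₁ h + a₂ v) × (b₁ h + b₂ v) = a₁ b₂ - a₂ b₁`. -/
def cross {p : ℕ} (s t : Loop p) : ZMod p := s.1 * t.2 - s.2 * t.1

/-- The phase `ζ_p ^ x`, where `ζ_p = exp (2 π i / p)` and `x : ℤ/p`. -/
def phase {p : ℕ} [NeZero p] (x : ZMod p) : ℂ := ZMod.stdAddChar x

/-- Operators on the `p²`-dimensional logical space, in the basis `|s⟩` labelled by loops. -/
abbrev LogicalOp (p : ℕ) : Type := Matrix (Loop p) (Loop p) ℂ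

/-- The `X`-loop operator: `X^s |t⟩ = |s + t⟩`. -/
def loopX {p : ℕ} (s : Loop p) : LogicalOp p :=
  Matrix.of fun i j => if i = s + j then 1 else 0

/-- The `Z`-loop operator: `Z^s |t⟩ = ζ_p ^ (s × t) |t⟩`. -/
def loopZ {p : ℕ} [NeZero p] (s : Loop p) : LogicalOp p :=
  Matrix.diagonal fun t => phase (cross s t)

/-! ### Channels on the logical space, given by their Choi matrices -/

/-- A matrix `Q_{(i,s);(j,t)}`: the first entry of each index is the output loop,
the second one is the input loop. -/
abbrev ChoiMatrix (p : ℕ) : Type := Matrix (Loop p × Loop p) (Loop p × Loop p) ℂ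

/-- The block `q_{s,t}` of `Q`: `(q_{s,t})_{i,j} = Q_{(i,s);(j,t)}`. -/
def block {p : ℕ} (Q : ChoiMatrix p) (s t : Loop p) : LogicalOp p :=
  Matrix.of fun i j => Q (i, s) (j, t)

/-- Hermiticity and positivity of `Q` (Mathlib's `PosSemidef` contains both), and the trace
normalization `tr q_{s,t} = δ(s - t)`. -/
def IsChannel {p : ℕ} [NeZero p] (Q : ChoiMatrix p) : Prop :=
  Q.PosSemidef ∧ ∀ s t : Loop p, (block Q s t).trace = if s = t then 1 else 0

/-- The linear map with Choi matrix `Q`: `Q[ρ]_{i,j} = ∑_{s,t} Q_{(i,s);(j,t)} ρ_{s,t}`. -/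
def applyChoi {p : ℕ} [NeZero p] (Q : ChoiMatrix p) (ρ : LogicalOp p) : LogicalOp p :=
  ∑ s : Loop p, ∑ t : Loop p, ρ s t • block Q s t

/-- A family of syndromes `θ`, each with its probability `Pr(θ) > 0` and with the Choi matrix
`Q(θ)` of the logical channel conditioned on `θ`. -/
structure LogicalEnsemble (p : ℕ) [NeZero p] (Θ : Type*) [Fintype Θ] where
  prob : Θ → ℝ
  prob_pos : ∀ θ, 0 < prob θ
  prob_sum : ∑ θ, prob θ = 1
  choi : Θ → ChoiMatrix p
  isChannel : ∀ θ, IsChannel (choi θ)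

/-! ### The `X`-loop expectation tensor of the `n`-replica network -/

/-- The layer of the ket side of the `i`-th replica (layers are numbered from `0`). -/
def ket {n : ℕ} (i : Fin n) : Fin (2 * n) := ⟨2 * i.1, by omega⟩

/-- The layer of the bra side of the `i`-th replica. -/
def bra {n : ℕ} (i : Fin n) : Fin (2 * n) := ⟨2 * i.1 + 1, by omega⟩

/-- A tensor with `2n` loop indices, one for each layer. -/
abbrev LoopTensor (p n : ℕ) : Type := (Fin (2 * n) → Loop p) → ℂ

/-- `tr (q_{t₁,-t₂} q_{t₃,-t₄} ⋯ q_{t_{2n-1},-t_{2n}})`. -/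
def replicaTrace {p n : ℕ} [NeZero p] (Q : ChoiMatrix p) (t : Fin (2 * n) → Loop p) : ℂ :=
  ((List.ofFn fun i : Fin n => block Q (t (ket i)) (-t (bra i))).prod).trace

/-- The `X`-loop expectation tensor
`⟨X₁^{t₁} ⋯ X_{2n}^{t_{2n}}⟩ =
  ∑_θ Pr(θ)ⁿ tr (q_{t₁,-t₂} ⋯ q_{t_{2n-1},-t_{2n}}) / ∑_θ Pr(θ)ⁿ tr (q_{0,0}ⁿ)`. -/
def LogicalEnsemble.expectation {p : ℕ} [NeZero p] {Θ : Type*} [Fintype Θ]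
    (E : LogicalEnsemble p Θ) (n : ℕ) : LoopTensor p n := fun t =>
  (∑ θ, (E.prob θ : ℂ) ^ n * replicaTrace (E.choi θ) t) /
    (∑ θ, (E.prob θ : ℂ) ^ n * ((block (E.choi θ) 0 0) ^ n).trace)

/-! ### Boundary SPT orders -/

/-- The symmetry group `(ℤ/p)^{2n}` of the layers, written additively. -/
abbrev LayerGroup (p n : ℕ) : Type := Fin (2 * n) → ZMod p

/-- The generator `x_k` of the symmetry of layer `k`. -/
def gen {p n : ℕ} (k : Fin (2 * n)) : LayerGroup p n := Pi.single k 1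

/-- A boundary SPT order: a subgroup `G` of `(ℤ/p)^{2n}` and an alternating bimultiplicative
function `χ : G × G → ℂˣ`. -/
@[ext]
structure SPTOrder (p n : ℕ) where
  G : AddSubgroup (LayerGroup p n)
  χ : G → G → ℂˣ
  χ_add_left : ∀ a b c : G, χ (a + b) c = χ a c * χ b c
  χ_add_right : ∀ a b c : G, χ a (b + c) = χ a b * χ a c
  χ_self : ∀ a : G, χ a a = 1

open Classical in
/-- The expectation tensor of an SPT order: with `t_k = a_k h + b_k v`, it is `χ(a, b)` if both
`a` and `b` lie in `G`, and `0` otherwise. -/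
def SPTOrder.tensor {p n : ℕ} (S : SPTOrder p n) : LoopTensor p n := fun t =>
  if h : (fun k => (t k).1) ∈ S.G ∧ (fun k => (t k).2) ∈ S.G then
    (S.χ ⟨_, h.1⟩ ⟨_, h.2⟩ : ℂ)
  else 0

/-! ### The classes -/

/-- The labels of the classes: Case 1, Case 2, Case 3a, Case 3b with `c = 1, …, p - 1`
(an invertible element of `ℤ/p`, `p` prime), Case 4. -/
inductive Case (p : ℕ) : Type
  | case1 : Case p
  | case2 : Case p
  | case3a : Case p
  | case3b (c : (ZMod p)ˣ) : Case p
  | case4 : Case p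

/-- The generators of the boundary symmetry group in each class. The map `finRotate` sends
layer `k` to the cyclically next layer `k + 1`. -/
def Case.generators {p : ℕ} (n : ℕ) : Case p → Set (LayerGroup p n)
  | .case1 => {g | ∃ i : Fin n, g = gen (ket i) - gen (bra i)}
  | .case2 => {∑ i : Fin n, (gen (ket i) - gen (bra i))}
  | .case3a => {g | ∃ j k : Fin (2 * n), j.1 = 0 ∧ g = gen j - gen k}
  | .case3b _ => {g | ∃ j k : Fin (2 * n), j.1 = 0 ∧ g = gen j - gen k}
  | .case4 => {g | ∃ i : Fin n, g = gen (bra i) - gen (finRotate (2 * n) (bra i))}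

/-- The exponent `c` of the alternating function: it vanishes except in Case 3b. -/
def Case.exponent {p : ℕ} : Case p → ZMod p
  | .case3b c => c
  | _ => 0

/-- The alternating form `∑_{i<j} (a_i b_j - a_j b_i)` on `(ℤ/p)^{2n}`. -/
def altForm {p n : ℕ} (a b : LayerGroup p n) : ZMod p :=
  ∑ i : Fin (2 * n), ∑ j ∈ Finset.Ioi i, (a i * b j - a j * b i)

theorem altForm_add_left {p n : ℕ} (a b c : LayerGroup p n) :
    altForm (a + b) c = altForm a c + altForm b c := by
  simp only [altForm, ← Finset.sum_add_distrib, Pi.add_apply]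
  refine Finset.sum_congr rfl fun i _ => Finset.sum_congr rfl fun j _ => by ring

theorem altForm_add_right {p n : ℕ} (a b c : LayerGroup p n) :
    altForm a (b + c) = altForm a b + altForm a c := by
  simp only [altForm, ← Finset.sum_add_distrib, Pi.add_apply]
  refine Finset.sum_congr rfl fun i _ => Finset.sum_congr rfl fun j _ => by ring

theorem altForm_self {p n : ℕ} (a : LayerGroup p n) : altForm a a = 0 :=
  Finset.sum_eq_zero fun i _ => Finset.sum_eq_zero fun j _ => by ring

/-- The boundary SPT order of each class: the group is given by its generators, and
`χ(a, b) = ζ_p ^ (c ∑_{i<j} (a_i b_j - a_j b_i))` (so `χ = 1` except in Case 3b). -/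
def Case.spt {p : ℕ} [NeZero p] (n : ℕ) (κ : Case p) : SPTOrder p n where
  G := AddSubgroup.closure (κ.generators n)
  χ a b := Circle.toUnits (ZMod.toCircle (κ.exponent * altForm a.1 b.1))
  χ_add_left a b c := by
    rw [← map_mul, ← AddChar.map_add_eq_mul, ← mul_add, ← altForm_add_left]; rfl
  χ_add_right a b c := by
    rw [← map_mul, ← AddChar.map_add_eq_mul, ← mul_add, ← altForm_add_right]; rfl
  χ_self a := by
    rw [altForm_self, mul_zero, AddChar.map_zero_eq_one, map_one]

/-- The delta function `δ(s)` of a loop. -/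
def delta {p : ℕ} (s : Loop p) : ℂ := if s = 0 then 1 else 0

/-- The explicit expectation tensor of each class:
Case 1 is `δ(t₁+t₂) δ(t₃+t₄) ⋯ δ(t_{2n-1}+t_{2n})`,
Case 2 is `δ(t₁+t₂) δ(t₂+t₃) ⋯ δ(t_{2n}+t₁)`,
Case 3a is `δ(t₁+⋯+t_{2n})`,
Case 3b is `δ(t₁+⋯+t_{2n}) ∏_{i<j} ζ_p ^ (c (t_i × t_j))`,
Case 4 is `δ(t₂+t₃) δ(t₄+t₅) ⋯ δ(t_{2n}+t₁)`. -/
def Case.tensor {p : ℕ} [NeZero p] (n : ℕ) : Case p → LoopTensor p n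
  | .case1 => fun t => ∏ i : Fin n, delta (t (ket i) + t (bra i))
  | .case2 => fun t => ∏ k : Fin (2 * n), delta (t k + t (finRotate (2 * n) k))
  | .case3a => fun t => delta (∑ k, t k)
  | .case3b c => fun t =>
      delta (∑ k, t k) *
        ∏ i : Fin (2 * n), ∏ j ∈ Finset.Ioi i, phase ((c : ZMod p) * cross (t i) (t j))
  | .case4 => fun t => ∏ i : Fin n, delta (t (bra i) + t (finRotate (2 * n) (bra i)))

/-! ### The code space channels of the classes -/

/-- Dephasing by the `Z`-loops: `p⁻² ∑_s Z^s ρ Z^{-s}`. -/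
def dephaseZ {p : ℕ} [NeZero p] (ρ : LogicalOp p) : LogicalOp p :=
  ((p : ℂ) ^ 2)⁻¹ • ∑ s : Loop p, loopZ s * ρ * loopZ (-s)

/-- Dephasing by the `X`-loops: `p⁻² ∑_s X^s ρ X^{-s}`. -/
def dephaseX {p : ℕ} [NeZero p] (ρ : LogicalOp p) : LogicalOp p :=
  ((p : ℂ) ^ 2)⁻¹ • ∑ s : Loop p, loopX s * ρ * loopX (-s)

/-- The channel `p⁻² ∑_s X^s Z^{-cs} ρ Z^{cs} X^{-s}`. -/
def dephaseXZ {p : ℕ} [NeZero p] (c : ZMod p) (ρ : LogicalOp p) : LogicalOp p :=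
  ((p : ℂ) ^ 2)⁻¹ •
    ∑ s : Loop p, loopX s * loopZ (-(c • s)) * ρ * loopZ (c • s) * loopX (-s)

/-- `Q` is the map `N` followed by a unitary: `Q[ρ] = U N[ρ] U†`. -/
def EqUpToUnitary {p : ℕ} [NeZero p] (Q : ChoiMatrix p) (N : LogicalOp p → LogicalOp p) : Prop :=
  ∃ U ∈ Matrix.unitaryGroup (Loop p) ℂ, ∀ ρ, applyChoi Q ρ = U * N ρ * Uᴴ

/-- `Q` has the normal form of a class: in Case 1 every state goes to the fixed state `q_{0,0}`;
in the other cases `Q` is, up to a unitary, `Z`-dephasing, `X`-dephasing, `X Z^{-c}`-dephasing or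
the identity. -/
def Case.NormalForm {p : ℕ} [NeZero p] (Q : ChoiMatrix p) : Case p → Prop
  | .case1 => ∀ ρ, applyChoi Q ρ = ρ.trace • block Q 0 0
  | .case2 => EqUpToUnitary Q dephaseZ
  | .case3a => EqUpToUnitary Q dephaseX
  | .case3b c => EqUpToUnitary Q (dephaseXZ (c : ZMod p))
  | .case4 => EqUpToUnitary Q id

/-- `N` is the effective channel of `Q` under optimal recovery: some recovery channel `R` turns
`Q` into `N`, and no information is lost in doing so, since some channel `S` turns `N` back
into `Q`. -/
def IsOptimallyRecovered {p : ℕ} [NeZero p] (Q : ChoiMatrix p)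
    (N : LogicalOp p → LogicalOp p) : Prop :=
  ∃ R S : ChoiMatrix p, IsChannel R ∧ IsChannel S ∧
    (∀ ρ, applyChoi R (applyChoi Q ρ) = N ρ) ∧ (∀ ρ, applyChoi S (N ρ) = applyChoi Q ρ)

end ToricCode

end

namespace ToricCode

variable {p n : ℕ}

/-! ### Layers -/

/-! Positivity of each `Q(θ)` gives a factorization of its blocks, `q_{s,t} = F_s F_t†`. Putting the
rectangular matrices `F_s` into the corner of square ones and collecting all syndromes yields a
family `A_s` in a finite product of matrix algebras. This product carries the faithful trace `τ`
that weights the component `θ` by `Pr(θ)ⁿ`. The hypothesis becomes: the cyclic words `τ(A_{t₁}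
A_{-t₂}* A_{t₃} A_{-t₄}* ⋯)` equal `D` times the SPT tensor, with `D = τ((A_0 A_0*)ⁿ) ≠ 0`
(`Realizes`). Everything else is algebra with a faithful trace.

Cyclicity of `τ` provides a duality: passing from `A_x` to `A_{-x}*` shifts all layers by one
(`IsFaithfulTrace.replica_dual`), so `G` and `χ` are invariant under a shift by two layers. Since
`τ((A_x A_x*)ⁿ) ≠ 0`, the alternating element always lies in `G`.

The classification depends on two questions: is `x₁x₂⁻¹` in `G`, and is `x₂x₃⁻¹` in `G`? If `x₂x₃⁻¹
∉ G`, a certain word vanishes, and faithfulness gives `A_x A_y* = 0` for `x ≠ y`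
(`Realizes.mul_star_eq_zero`). If `x₁x₂⁻¹ ∈ G`, all mixed moments of `A_x A_x*` and `A_0 A_0*`
agree, so these elements are equal (`Realizes.mul_star_eq`). Duality gives the same for `A_x* A_y`,
with the roles of the two generators exchanged. The answers yes/no, no/no and no/yes are Cases 1, 2
and 4, where the relations already fix the tensor.

If both answers are yes, the value of `χ` on the two generators is some `ζ_p^c`. Equality in the
Cauchy–Schwarz inequality then turns the tensor values at `(a, b, -(a+b), 0, …)` into the twisted
relation `A_a A_{-b}* = ζ_p^{c a×b} A_0 A_{-(a+b)}*` (`Realizes.exists_weylRelations`). It evaluates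
every word (`prod_weyl`) and gives Case 3a for `c = 0` and Case 3b otherwise.

For the channels, the relations among the `F_s` become relations among the blocks. In Cases 2 and 4
the blocks `q_{s,s}` are orthogonal, and there are as many of them as the dimension, so they are
rank-one projections (`exists_unitary_of_orthogonal`); in Case 4 all blocks form a system of matrix
units. In Case 3a the blocks `q_{0,-u}` multiply like the loop group up to the factor `q_{0,0}`, and
a Fourier transform diagonalizes them. In Case 3b the multiplication is projective, and an explicit
recovery map built from `q_{0,0}^{-1/2}` is used (`isOptimallyRecovered`). The converse evaluates
the words on the normal forms. -/

theorem finRotate_ket (i : Fin n) : finRotate (2 * n) (ket i) = bra i := by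
  obtain ⟨k, rfl⟩ : ∃ k, n = k + 1 := ⟨n - 1, by have := i.2; omega⟩
  have := i.2
  exact finRotate_of_lt (n := 2 * k + 1) (k := 2 * i.1) (by omega)

theorem finRotate_bra (i : Fin n) : finRotate (2 * n) (bra i) = ket (finRotate n i) := by
  obtain ⟨k, rfl⟩ : ∃ k, n = k + 1 := ⟨n - 1, by have := i.2; omega⟩
  rcases lt_or_eq_of_le (Nat.lt_succ_iff.mp i.2) with h | h
  · have h1 := finRotate_of_lt (n := 2 * k + 1) (k := 2 * i.1 + 1) (by omega)
    have h2 := finRotate_of_lt (n := k) (k := i.1) h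
    have h3 : finRotate (k + 1) i = ⟨i.1 + 1, by omega⟩ := h2
    exact h1.trans (by rw [h3]; rfl)
  · have h1 : bra i = Fin.last (2 * k + 1) := Fin.ext (by simp [bra, h])
    have h2 : i = Fin.last k := Fin.ext h
    have h3 := (finRotate_last (n := 2 * k + 1))
    rw [h1]
    refine h3.trans ?_
    rw [h2, finRotate_last]
    rfl

theorem ket_or_bra (k : Fin (2 * n)) : ∃ i : Fin n, k = ket i ∨ k = bra i := by
  have := k.2
  refine ⟨⟨k.1 / 2, by omega⟩, ?_⟩
  rcases Nat.mod_two_eq_zero_or_one k.1 with h | h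
  · left; ext; simp only [ket]; omega
  · right; ext; simp only [bra]; omega

theorem ket_ne_bra (i j : Fin n) : ket i ≠ bra j := by
  intro h
  have := congrArg Fin.val h
  simp only [ket, bra] at this
  omega

theorem ket_injective : Function.Injective (ket (n := n)) := fun i j h => by
  have := congrArg Fin.val h
  simp only [ket] at this
  exact Fin.ext (by omega)

theorem bra_injective : Function.Injective (bra (n := n)) := fun i j h => by
  have := congrArg Fin.val h
  simp only [bra] at this
  exact Fin.ext (by omega)

theorem forall_layer {P : Fin (2 * n) → Prop} (hk : ∀ i, P (ket i)) (hb : ∀ i, P (bra i)) (k) :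
    P k := by
  obtain ⟨i, rfl | rfl⟩ := ket_or_bra k
  exacts [hk i, hb i]

theorem prod_layer {M : Type*} [CommMonoid M] (f : Fin (2 * n) → M) :
    ∏ k, f k = (∏ i, f (ket i)) * ∏ i, f (bra i) := by
  let g : Fin n ⊕ Fin n → Fin (2 * n) := Sum.elim ket bra
  have hg : Function.Bijective g := by
    constructor
    · rintro (i | i) (j | j) h
      · exact congrArg _ (ket_injective h)
      · exact absurd h (ket_ne_bra i j)
      · exact absurd h.symm (ket_ne_bra j i)
      · exact congrArg _ (bra_injective h)
    · intro k
      obtain ⟨i, rfl | rfl⟩ := ket_or_bra k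
      exacts [⟨Sum.inl i, rfl⟩, ⟨Sum.inr i, rfl⟩]
  rw [← Function.Bijective.prod_comp hg, Fintype.prod_sum_type]
  rfl

theorem sum_layer {M : Type*} [AddCommMonoid M] (f : Fin (2 * n) → M) :
    ∑ k, f k = ∑ i, (f (ket i) + f (bra i)) := by
  have := prod_layer (M := Multiplicative M) f
  rw [Finset.sum_add_distrib]
  exact this

/-- The generator difference `x_k x_{k+1}⁻¹` of two cyclically adjacent layers. -/
def adj (k : Fin (2 * n)) : LayerGroup p n := gen k - gen (finRotate (2 * n) k)

theorem adj_ket (i : Fin n) : adj (p := p) (ket i) = gen (ket i) - gen (bra i) := by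
  rw [adj, finRotate_ket]

theorem sum_smul_gen (g : LayerGroup p n) : ∑ k, g k • gen k = g := by
  funext l
  simp [gen, Finset.sum_apply, Pi.single_apply]

theorem sum_smul_adj_ket (g : LayerGroup p n) (hg : ∀ i, g (ket i) + g (bra i) = 0) :
    ∑ i, g (ket i) • adj (ket i) = g := by
  conv_rhs => rw [← sum_smul_gen g, sum_layer]
  refine Finset.sum_congr rfl fun i _ => ?_
  rw [adj_ket, eq_neg_of_add_eq_zero_right (hg i), smul_sub, neg_smul, sub_eq_add_neg]

theorem zmod_smul_mem [NeZero p] (H : AddSubgroup (LayerGroup p n)) (c : ZMod p)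
    {g : LayerGroup p n}
    (hg : g ∈ H) : c • g ∈ H := by
  have : c • g = c.val • g := by
    rw [← Nat.cast_smul_eq_nsmul (ZMod p), ZMod.natCast_zmod_val]
  rw [this]
  exact H.nsmul_mem hg _

theorem mem_of_adj_ket_mem [NeZero p] (H : AddSubgroup (LayerGroup p n)) (hH : ∀ i, adj (ket i) ∈ H)
    (g : LayerGroup p n) (hg : ∀ i, g (ket i) + g (bra i) = 0) : g ∈ H := by
  rw [← sum_smul_adj_ket g hg]
  exact sum_mem fun i _ => zmod_smul_mem H _ (hH i)

theorem gen_apply (k l : Fin (2 * n)) : (gen k : LayerGroup p n) l = if l = k then 1 else 0 := by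
  simp [gen, Pi.single_apply]

theorem gen_comp_rotate (k : Fin (2 * n)) :
    (gen (p := p) (finRotate (2 * n) k)) ∘ finRotate (2 * n) = gen k := by
  funext l
  simp [gen_apply]

theorem adj_comp_rotate (k : Fin (2 * n)) :
    (adj (p := p) (finRotate (2 * n) k)) ∘ finRotate (2 * n) = adj k := by
  rw [adj, adj, ← gen_comp_rotate k, ← gen_comp_rotate (finRotate (2 * n) k)]
  rfl

/-- The alternating element `x_1 x_2⁻¹ ⋯ x_{2n-1} x_{2n}⁻¹`. -/
def alternating (p n : ℕ) : LayerGroup p n := ∑ i : Fin n, adj (ket i)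

theorem sum_smul_adj_ket_apply_ket (f : Fin n → ZMod p) (i : Fin n) :
    (∑ j, f j • adj (ket j) : LayerGroup p n) (ket i) = f i := by
  simp [Finset.sum_apply, adj_ket, gen_apply, ket_ne_bra, ket_injective.eq_iff]

theorem sum_smul_adj_ket_apply_bra (f : Fin n → ZMod p) (i : Fin n) :
    (∑ j, f j • adj (ket j) : LayerGroup p n) (bra i) = -f i := by
  simp [Finset.sum_apply, adj_ket, gen_apply, (ket_ne_bra _ _).symm, bra_injective.eq_iff]

theorem alternating_ket (i : Fin n) : alternating p n (ket i) = 1 := by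
  simpa [alternating] using sum_smul_adj_ket_apply_ket (fun _ => (1 : ZMod p)) i

theorem alternating_bra (i : Fin n) : alternating p n (bra i) = -1 := by
  simpa [alternating] using sum_smul_adj_ket_apply_bra (fun _ => (1 : ZMod p)) i

/-! ### The groups of the classes -/

theorem mem_closure_case1 [NeZero p] (g : LayerGroup p n) :
    g ∈ AddSubgroup.closure (Case.case1.generators (p := p) n) ↔
      ∀ i, g (ket i) + g (bra i) = 0 := by
  constructor
  · intro h
    induction h using AddSubgroup.closure_induction with
    | mem x hx =>
      obtain ⟨j, rfl⟩ := hx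
      intro i
      simp [gen_apply, ket_ne_bra, (ket_ne_bra _ _).symm, ket_injective.eq_iff,
        bra_injective.eq_iff]
    | zero => simp
    | add x y _ _ hx hy =>
      intro i
      rw [Pi.add_apply, Pi.add_apply, add_add_add_comm, hx, hy, add_zero]
    | neg x _ hx => intro i; rw [Pi.neg_apply, Pi.neg_apply, ← neg_add, hx, neg_zero]
  · intro h
    exact mem_of_adj_ket_mem _
      (fun i => AddSubgroup.subset_closure (show adj (ket i) ∈ Case.case1.generators n from
        ⟨i, adj_ket i⟩)) g h

theorem mem_closure_case4 [NeZero p] (g : LayerGroup p n) :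
    g ∈ AddSubgroup.closure (Case.case4.generators (p := p) n) ↔
      ∀ i, g (bra i) + g (finRotate (2 * n) (bra i)) = 0 := by
  constructor
  · intro h
    induction h using AddSubgroup.closure_induction with
    | mem x hx =>
      obtain ⟨j, rfl⟩ := hx
      intro i
      simp [-finRotate_apply, gen_apply, finRotate_bra, ket_ne_bra, (ket_ne_bra _ _).symm,
        ket_injective.eq_iff, bra_injective.eq_iff]
    | zero => simp
    | add x y _ _ hx hy =>
      intro i
      rw [Pi.add_apply, Pi.add_apply, add_add_add_comm, hx, hy, add_zero]
    | neg x _ hx => intro i; rw [Pi.neg_apply, Pi.neg_apply, ← neg_add, hx, neg_zero]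
  · intro h
    -- Relabelling the layers by the cyclic shift carries the pairs (ket, bra) to the pairs (bra,
    -- next ket), which reduces the claim to the criterion used in Case 1.
    let r : (Fin (2 * n) → ZMod p) ≃+ (Fin (2 * n) → ZMod p) :=
      { Equiv.arrowCongr (finRotate (2 * n)) (Equiv.refl (ZMod p)) with
        map_add' := fun _ _ => rfl }
    have hr (f : Fin (2 * n) → ZMod p) : r f = f ∘ (finRotate (2 * n)).symm := rfl
    have := mem_of_adj_ket_mem
      ((AddSubgroup.closure (Case.case4.generators (p := p) n)).comap r.toAddMonoidHom)
      (fun i => ?_) (g ∘ finRotate (2 * n)) fun i => ?_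
    · rw [AddSubgroup.mem_comap] at this
      simpa [hr, Function.comp_assoc] using this
    · rw [AddSubgroup.mem_comap]
      apply AddSubgroup.subset_closure
      refine ⟨i, ?_⟩
      change r (adj (ket i)) = _
      rw [hr, ← adj_comp_rotate, finRotate_ket]
      simp [Function.comp_assoc, adj]
    · simpa only [Function.comp_apply, finRotate_ket] using h i

theorem sum_eq_zero_of_mem_case3 (g : LayerGroup p n)
    (h : g ∈ AddSubgroup.closure (Case.case3a.generators (p := p) n)) : ∑ k, g k = 0 := by
  induction h using AddSubgroup.closure_induction with
  | mem x hx =>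
    obtain ⟨j, k, -, rfl⟩ := hx
    simp [gen_apply]
  | zero => simp
  | add x y _ _ hx hy => simp [Finset.sum_add_distrib, hx, hy]
  | neg x _ hx => simp [hx]

theorem mem_closure_case3 [NeZero p] [NeZero n] (g : LayerGroup p n) :
    g ∈ AddSubgroup.closure (Case.case3a.generators (p := p) n) ↔ ∑ k, g k = 0 := by
  refine ⟨sum_eq_zero_of_mem_case3 g, fun h => ?_⟩
  have hn := NeZero.pos n
  let z : Fin (2 * n) := ⟨0, by omega⟩
  -- The multiples of the zeroth generator add up to the total exponent, which vanishes.
  have : g = -∑ k, g k • (gen z - gen k) := by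
    simp only [smul_sub, Finset.sum_sub_distrib, ← Finset.sum_smul, h, zero_smul, sum_smul_gen]
    simp
  rw [this]
  exact neg_mem (sum_mem fun k _ => zmod_smul_mem _ _ (AddSubgroup.subset_closure ⟨z, k, rfl, rfl⟩))

/-- Neighbouring entries are opposite, so all ket entries agree and all bra entries are their
negatives. -/
theorem eq_smul_alternating [NeZero n] (g : LayerGroup p n)
    (h : ∀ k, g k + g (finRotate (2 * n) k) = 0) :
    g = g (ket ⟨0, NeZero.pos n⟩) • alternating p n := by
  have hk : ∀ (i : ℕ) (hi : i < n), g (ket ⟨i, hi⟩) = g (ket ⟨0, NeZero.pos n⟩) := by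
    intro i
    induction i with
    | zero => intro _; rfl
    | succ i ih =>
      intro hi
      have h1 := h (ket ⟨i, by omega⟩)
      have h2 := h (bra ⟨i, by omega⟩)
      obtain ⟨k, rfl⟩ : ∃ k, n = k + 1 := ⟨n - 1, by omega⟩
      rw [finRotate_ket] at h1
      rw [finRotate_bra, finRotate_of_lt (k := i) (by omega)] at h2
      rw [← ih (by omega)]
      exact (eq_neg_of_add_eq_zero_right h2).trans (eq_neg_of_add_eq_zero_left h1).symm
  funext k
  refine forall_layer (P := fun k => g k = (g (ket ⟨0, NeZero.pos n⟩) • alternating p n) k)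
    (fun i => ?_) (fun i => ?_) k
  · simp [alternating_ket, hk i.1 i.2]
  · have h1 := h (ket i)
    rw [finRotate_ket] at h1
    simp only [Pi.smul_apply, smul_eq_mul, alternating_bra, mul_neg, mul_one, ← hk i.1 i.2]
    exact eq_neg_of_add_eq_zero_right h1

theorem alternating_add_rotate (k : Fin (2 * n)) :
    alternating p n k + alternating p n (finRotate (2 * n) k) = 0 := by
  revert k
  refine forall_layer (fun i => ?_) (fun i => ?_)
  · rw [finRotate_ket, alternating_ket, alternating_bra, add_neg_cancel]
  · rw [finRotate_bra, alternating_ket, alternating_bra, neg_add_cancel]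

theorem mem_closure_case2 [NeZero p] [NeZero n] (g : LayerGroup p n) :
    g ∈ AddSubgroup.closure (Case.case2.generators (p := p) n) ↔
      ∀ k, g k + g (finRotate (2 * n) k) = 0 := by
  have hg : Case.case2.generators (p := p) n = {alternating p n} := by
    simp [Case.generators, alternating, adj_ket]
  rw [hg]
  constructor
  · intro h
    induction h using AddSubgroup.closure_induction with
    | mem x hx => obtain rfl := hx; exact alternating_add_rotate
    | zero => simp
    | add x y _ _ hx hy =>
      intro i
      rw [Pi.add_apply, Pi.add_apply, add_add_add_comm, hx, hy, add_zero]
    | neg x _ hx => intro i; rw [Pi.neg_apply, Pi.neg_apply, ← neg_add, hx, neg_zero]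
  · intro h
    rw [eq_smul_alternating g h]
    exact zmod_smul_mem _ _ (AddSubgroup.subset_closure rfl)

variable {p n : ℕ}

/-! ### Phases -/

theorem phase_zero [NeZero p] : phase (0 : ZMod p) = 1 := AddChar.map_zero_eq_one _

theorem phase_add [NeZero p] (x y : ZMod p) : phase (x + y) = phase x * phase y :=
  AddChar.map_add_eq_mul _ _ _

theorem phase_ne_zero [NeZero p] (x : ZMod p) : phase x ≠ 0 := by
  intro h
  have := phase_add x (-x)
  rw [add_neg_cancel, phase_zero, h, zero_mul] at this
  exact one_ne_zero this

theorem star_phase [NeZero p] (x : ZMod p) : star (phase x) = phase (-x) := by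
  rw [phase, phase, ZMod.stdAddChar_apply, ZMod.stdAddChar_apply, AddChar.map_neg_eq_inv,
    Circle.coe_inv_eq_conj]
  rfl

theorem phase_mul_star [NeZero p] (x : ZMod p) : phase x * star (phase x) = 1 := by
  rw [star_phase, ← phase_add, add_neg_cancel, phase_zero]

theorem phase_injective [NeZero p] : Function.Injective (phase (p := p)) :=
  ZMod.injective_stdAddChar

theorem phase_sum [NeZero p] {ι : Type*} (s : Finset ι) (f : ι → ZMod p) :
    phase (∑ i ∈ s, f i) = ∏ i ∈ s, phase (f i) :=
  map_prod (ZMod.stdAddChar (N := p)).toMonoidHom (fun i => Multiplicative.ofAdd (f i)) s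

/-! ### The intersection product -/

theorem cross_add_left (a b c : Loop p) : cross (a + b) c = cross a c + cross b c := by
  simp [cross]; ring

theorem cross_add_right (a b c : Loop p) : cross a (b + c) = cross a b + cross a c := by
  simp [cross]; ring

theorem cross_neg_left (a b : Loop p) : cross (-a) b = -cross a b := by
  simp [cross]; ring

theorem cross_neg_right (a b : Loop p) : cross a (-b) = -cross a b := by
  simp [cross]; ring

theorem cross_self (a : Loop p) : cross a a = 0 := by
  simp [cross]; ring

theorem cross_comm (a b : Loop p) : cross a b = -cross b a := by
  simp [cross]; ring

theorem cross_zero_left (a : Loop p) : cross 0 a = 0 := by simp [cross]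

theorem cross_zero_right (a : Loop p) : cross a 0 = 0 := by simp [cross]

theorem cross_sum_right {ι : Type*} (s : Finset ι) (a : Loop p) (f : ι → Loop p) :
    cross a (∑ i ∈ s, f i) = ∑ i ∈ s, cross a (f i) :=
  map_sum (AddMonoidHom.mk' (cross a) (cross_add_right a)) f s

/-- The sum `∑_{i<j} t_i × t_j` of all ordered intersection products of a sequence of loops. -/
def altSum {m : ℕ} (t : Fin m → Loop p) : ZMod p :=
  ∑ i, ∑ j ∈ Finset.Ioi i, cross (t i) (t j)

theorem altSum_succ {m : ℕ} (t : Fin (m + 1) → Loop p) :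
    altSum t = cross (t 0) (∑ i, t (Fin.succ i)) + altSum (fun i => t (Fin.succ i)) := by
  rw [altSum, Fin.sum_univ_succ, Fin.sum_Ioi_zero, cross_sum_right]
  simp only [Fin.sum_Ioi_succ]
  rfl

theorem altForm_eq_altSum (t : Fin (2 * n) → Loop p) :
    altForm (fun k => (t k).1) (fun k => (t k).2) = altSum t :=
  Finset.sum_congr rfl fun i _ => Finset.sum_congr rfl fun j _ => by simp only [cross]; ring

theorem phase_mul_altSum [NeZero p] (c : ZMod p) (t : Fin (2 * n) → Loop p) :
    phase (c * altSum t) =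
      ∏ i : Fin (2 * n), ∏ j ∈ Finset.Ioi i, phase (c * cross (t i) (t j)) := by
  simp only [altSum, Finset.mul_sum, phase_sum]

/-! ### The tensors of the classes -/

open Classical in
theorem prod_delta {ι : Type*} [Fintype ι] (f : ι → Loop p) :
    ∏ i, delta (f i) = if ∀ i, f i = 0 then 1 else 0 := by
  simp only [delta, Finset.prod_boole, Finset.mem_univ, true_imp_iff]

open Classical in
theorem spt_tensor_apply [NeZero p] (κ : Case p) (t : Fin (2 * n) → Loop p) :
    (κ.spt n).tensor t =
      if (fun k => (t k).1) ∈ AddSubgroup.closure (κ.generators n) ∧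
        (fun k => (t k).2) ∈ AddSubgroup.closure (κ.generators n) then
      phase (κ.exponent * altSum t) else 0 := by
  rw [← altForm_eq_altSum]
  simp only [SPTOrder.tensor]
  rfl

/-- A linear condition on loops is the same condition on the `h`- and on the `v`-components; each of
these is membership in the group generated by the class. -/
theorem spt_tensor [NeZero p] [NeZero n] (κ : Case p) : (κ.spt n).tensor = κ.tensor n := by
  classical
  funext t
  rw [spt_tensor_apply]
  cases κ with
  | case1 =>
    simp only [mem_closure_case1, Case.tensor, prod_delta, Case.exponent, zero_mul, phase_zero]
    simp only [← forall_and, Prod.ext_iff, Prod.fst_add, Prod.snd_add, Prod.fst_zero, Prod.snd_zero]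
  | case2 =>
    simp only [mem_closure_case2, Case.tensor, prod_delta, Case.exponent, zero_mul, phase_zero]
    simp only [← forall_and, Prod.ext_iff, Prod.fst_add, Prod.snd_add, Prod.fst_zero, Prod.snd_zero]
  | case3a =>
    simp only [mem_closure_case3, Case.tensor, delta, Case.exponent, zero_mul, phase_zero]
    refine if_congr ?_ rfl rfl
    simp only [Prod.ext_iff, Prod.fst_sum, Prod.snd_sum, Prod.fst_zero, Prod.snd_zero]
  | case3b c =>
    have : (Case.case3b c).generators n = Case.case3a.generators n := rfl
    rw [this]
    simp only [mem_closure_case3, Case.tensor, delta, Case.exponent, phase_mul_altSum, ite_mul,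
      one_mul, zero_mul]
    refine if_congr ?_ rfl rfl
    simp only [Prod.ext_iff, Prod.fst_sum, Prod.snd_sum, Prod.fst_zero, Prod.snd_zero]
  | case4 =>
    simp only [mem_closure_case4, Case.tensor, prod_delta, Case.exponent, zero_mul, phase_zero]
    simp only [← forall_and, Prod.ext_iff, Prod.fst_add, Prod.snd_add, Prod.fst_zero, Prod.snd_zero]

theorem SPTOrder.tensor_of_mem (S : SPTOrder p n) (a b : S.G) :
    S.tensor (fun k => (a.1 k, b.1 k)) = S.χ a b := by
  have h : (fun k => a.1 k) ∈ S.G ∧ (fun k => b.1 k) ∈ S.G := ⟨a.2, b.2⟩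
  exact dif_pos h

theorem SPTOrder.tensor_ne_zero_iff (S : SPTOrder p n) (t : Fin (2 * n) → Loop p) :
    S.tensor t ≠ 0 ↔ (fun k => (t k).1) ∈ S.G ∧ (fun k => (t k).2) ∈ S.G := by
  constructor
  · intro h
    by_contra h'
    exact h (dif_neg h')
  · intro h
    rw [SPTOrder.tensor, dif_pos h]
    exact Units.ne_zero _

/-- The support on configurations with vanishing `v`-components is `G`, since `0 ∈ G`; the values on
`G × G` are `χ`. Thus SPT orders may be compared through their tensors. -/
theorem SPTOrder.tensor_injective :
    Function.Injective (SPTOrder.tensor : SPTOrder p n → LoopTensor p n) := by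
  intro S S' h
  have hG : S.G = S'.G := by
    ext g
    have h1 := S.tensor_ne_zero_iff fun k => (g k, 0)
    have h2 := S'.tensor_ne_zero_iff fun k => (g k, 0)
    rw [h, h2] at h1
    have z (H : AddSubgroup (LayerGroup p n)) : (fun _ => 0) ∈ H := H.zero_mem
    simpa only [z, and_true] using h1.symm
  have hχ (a b : LayerGroup p n) (ha : a ∈ S.G) (hb : b ∈ S.G) (ha' : a ∈ S'.G) (hb' : b ∈ S'.G) :
      S.χ ⟨a, ha⟩ ⟨b, hb⟩ = S'.χ ⟨a, ha'⟩ ⟨b, hb'⟩ := by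
    have h1 := S.tensor_of_mem ⟨a, ha⟩ ⟨b, hb⟩
    have h2 := S'.tensor_of_mem ⟨a, ha'⟩ ⟨b, hb'⟩
    rw [h] at h1
    exact Units.ext (h1.symm.trans h2)
  obtain ⟨G, χ, _, _, _⟩ := S
  obtain ⟨G', χ', _, _, _⟩ := S'
  obtain rfl : G = G' := hG
  congr 1
  funext a b
  exact hχ a.1 b.1 a.2 b.2 a.2 b.2

/-- The layer configuration `(a, b, -(a + b), 0, …, 0)`. -/
def triangle {m : ℕ} (a b : Loop p) : Fin (2 * (m + 2)) → Loop p :=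
  Fin.cons (n := 2 * m + 3) a (Fin.cons (n := 2 * m + 2) b
    (Fin.cons (n := 2 * m + 1) (-(a + b)) fun _ => 0))

theorem sum_triangle {m : ℕ} (a b : Loop p) : ∑ k, triangle (m := m) a b k = 0 := by
  have := Fin.sum_univ_succ (n := 2 * m + 3) (triangle (m := m) a b)
  refine this.trans ?_
  simp only [triangle, Fin.cons_zero, Fin.cons_succ]
  rw [Fin.sum_univ_succ]
  simp only [Fin.cons_zero, Fin.cons_succ]
  rw [Fin.sum_univ_succ]
  simp

/-- The third loop is opposite to the sum of the first two, so its products with them cancel. The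
triangle configurations therefore isolate a single intersection product. -/
theorem altSum_triangle {m : ℕ} (a b : Loop p) : altSum (triangle (m := m) a b) = cross a b := by
  have h0 : altSum (fun _ : Fin (2 * m + 1) => (0 : Loop p)) = 0 := by
    simp [altSum, cross_zero_left]
  refine (altSum_succ (m := 2 * m + 3) (triangle (m := m) a b)).trans ?_
  simp only [triangle, Fin.cons_zero, Fin.cons_succ]
  rw [altSum_succ, altSum_succ]
  simp only [Fin.cons_zero, Fin.cons_succ, h0]
  rw [Fin.sum_univ_succ]
  simp only [Fin.cons_zero, Fin.cons_succ, Finset.sum_const_zero, cross_zero_right, add_zero]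
  rw [Fin.sum_univ_succ]
  simp only [Fin.cons_zero, Fin.cons_succ, Finset.sum_const_zero, add_zero]
  simp [cross]; ring

/-- The exponents in Cases 3a and 3b together: `c = 0` is Case 3a. -/
noncomputable def case3 (c : ZMod p) : Case p := open Classical in
  if h : IsUnit c then .case3b h.unit else .case3a

theorem case3_tensor [Fact p.Prime] (c : ZMod p) (t : Fin (2 * n) → Loop p) :
    (case3 c).tensor n t = delta (∑ k, t k) * phase (c * altSum t) := by
  by_cases h : IsUnit c
  · rw [case3, dif_pos h, phase_mul_altSum]
    rfl
  · rw [case3, dif_neg h]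
    rw [isUnit_iff_ne_zero, not_not] at h
    simp [Case.tensor, h, phase_zero]

theorem case3_coe [Fact p.Prime] (c : (ZMod p)ˣ) : case3 (c : ZMod p) = .case3b c := by
  rw [case3, dif_pos c.isUnit]
  congr 1
  exact Units.ext rfl

theorem case3_zero [Fact p.Prime] : case3 (0 : ZMod p) = .case3a := by
  rw [case3, dif_neg not_isUnit_zero]

theorem case3_tensor_triangle [Fact p.Prime] {m : ℕ} (c : ZMod p) (a b : Loop p) :
    (case3 c).tensor (m + 2) (triangle a b) = phase (c * cross a b) := by
  rw [case3_tensor, sum_triangle, altSum_triangle, delta, if_pos rfl, one_mul]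

theorem case3_tensor_injective [Fact p.Prime] {m : ℕ} {c d : ZMod p}
    (h : (case3 c).tensor (m + 2) = (case3 d).tensor (m + 2)) : c = d := by
  -- Since `h × v = 1`, the value here is `ζ_p^c`, which determines `c`.
  have := congrFun h (triangle (1, 0) (0, 1))
  rw [case3_tensor_triangle, case3_tensor_triangle] at this
  simpa [cross] using phase_injective this

/-! ### Telling the classes apart by two adjacent generators -/

theorem rotate_zero_ne {m : ℕ} : finRotate (m + 2) (0 : Fin (m + 2)) ≠ 0 := by
  rw [finRotate_apply_zero]
  simp

theorem adj_ket_mem_iff [Fact p.Prime] {m : ℕ} (κ : Case p) :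
    adj (ket (0 : Fin (m + 2))) ∈ AddSubgroup.closure (κ.generators (m + 2)) ↔
      κ ≠ .case2 ∧ κ ≠ .case4 := by
  -- This is where two replicas are needed: the layer after `bra 0` is `ket 1`, distinct from `ket
  -- 0`, so the sum is `-1 + 0`.
  have h4 : ¬ (adj (p := p) (n := m + 2) (ket (0 : Fin (m + 2))) (bra (0 : Fin (m + 2))) +
      adj (p := p) (ket (0 : Fin (m + 2))) (finRotate (2 * (m + 2)) (bra (0 : Fin (m + 2)))) = 0) := by
    simp [-finRotate_apply, adj_ket, gen_apply, finRotate_bra, ket_ne_bra, (ket_ne_bra _ _).symm,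
      ket_injective.eq_iff, rotate_zero_ne]
  have h3 : ∑ k, adj (p := p) (n := m + 2) (ket (0 : Fin (m + 2))) k = 0 := by
    simp [adj_ket, gen_apply]
  cases κ with
  | case1 =>
    simp only [mem_closure_case1]
    simp [adj_ket, gen_apply, ket_ne_bra, (ket_ne_bra _ _).symm, ket_injective.eq_iff,
      bra_injective.eq_iff]
  | case2 =>
    rw [mem_closure_case2]
    simpa using ⟨bra (0 : Fin (m + 2)), h4⟩
  | case3a => simpa [mem_closure_case3] using h3
  | case3b c =>
    have : (Case.case3b c).generators (m + 2) = Case.case3a.generators (m + 2) := rfl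
    rw [this]
    simpa [mem_closure_case3] using h3
  | case4 =>
    rw [mem_closure_case4]
    simpa using ⟨0, h4⟩

theorem adj_bra_mem_iff [Fact p.Prime] {m : ℕ} (κ : Case p) :
    adj (bra (0 : Fin (m + 2))) ∈ AddSubgroup.closure (κ.generators (m + 2)) ↔
      κ ≠ .case2 ∧ κ ≠ .case1 := by
  have h4 : ¬ (adj (p := p) (n := m + 2) (bra (0 : Fin (m + 2))) (ket (0 : Fin (m + 2))) +
      adj (p := p) (bra (0 : Fin (m + 2))) (bra (0 : Fin (m + 2))) = 0) := by
    simp [-finRotate_apply, adj, gen_apply, finRotate_bra, ket_ne_bra, (ket_ne_bra _ _).symm,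
      ket_injective.eq_iff, rotate_zero_ne.symm]
  have h3 : ∑ k, adj (p := p) (n := m + 2) (bra (0 : Fin (m + 2))) k = 0 := by
    simp [adj, gen_apply]
  cases κ with
  | case1 =>
    rw [mem_closure_case1]
    simpa using ⟨0, h4⟩
  | case2 =>
    rw [mem_closure_case2]
    simp only [ne_eq, not_true_eq_false, false_and, iff_false]
    exact fun h => h4 (by simpa only [finRotate_ket] using h (ket (0 : Fin (m + 2))))
  | case3a => simpa [mem_closure_case3] using h3
  | case3b c =>
    have : (Case.case3b c).generators (m + 2) = Case.case3a.generators (m + 2) := rfl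
    rw [this]
    simpa [mem_closure_case3] using h3
  | case4 =>
    have := AddSubgroup.subset_closure (show adj (p := p) (bra (0 : Fin (m + 2))) ∈
      Case.case4.generators (m + 2) from
      ⟨0, rfl⟩)
    simpa using this

/-- The two membership tests separate all classes except 3a and the 3b's among themselves; these are
separated by the exponent. -/
theorem Case.tensor_injective [Fact p.Prime] (hn : 2 ≤ n) :
    Function.Injective (Case.tensor (p := p) n) := by
  obtain ⟨m, rfl⟩ : ∃ m, n = m + 2 := ⟨n - 2, by omega⟩
  intro κ κ' h
  have hG : AddSubgroup.closure (κ.generators (m + 2)) =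
      AddSubgroup.closure (κ'.generators (m + 2)) := by
    rw [← spt_tensor, ← spt_tensor] at h
    exact congrArg SPTOrder.G (SPTOrder.tensor_injective h)
  have h1 := adj_ket_mem_iff (m := m) κ
  have h2 := adj_bra_mem_iff (m := m) κ
  rw [hG, adj_ket_mem_iff] at h1
  rw [hG, adj_bra_mem_iff] at h2
  have h3 (c d : ZMod p) (hκ : κ = case3 c) (hκ' : κ' = case3 d) : κ = κ' := by
    subst hκ hκ'
    rw [case3_tensor_injective h]
  cases κ <;> cases κ' <;> first
    | rfl
    | exact h3 _ _ case3_zero.symm (case3_coe _).symm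
    | exact h3 _ _ (case3_coe _).symm case3_zero.symm
    | exact h3 _ _ (case3_coe _).symm (case3_coe _).symm
    | (exfalso; simp at h1 h2)

/-! ### Faithful traces -/

/-- A faithful tracial functional on a complex star algebra. -/
structure IsFaithfulTrace {R : Type*} [Ring R] [StarRing R] [Algebra ℂ R] (τ : R →ₗ[ℂ] ℂ) :
    Prop where
  comm : ∀ a b, τ (a * b) = τ (b * a)
  map_star : ∀ a, τ (star a) = star (τ a)
  faithful : ∀ a, τ (star a * a) = 0 → a = 0

section Trace

variable {R : Type*} [Ring R] [StarRing R] [Algebra ℂ R] {τ : R →ₗ[ℂ] ℂ}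

namespace IsFaithfulTrace

variable (hτ : IsFaithfulTrace τ)
include hτ

theorem eq_zero_of_star_mul_self {a : R} (h : star a * a = 0) : a = 0 :=
  hτ.faithful a (by rw [h, map_zero])

/-- A Hermitian `h = BB*` annihilates whatever a power of it annihilates: for `V = h^(k+1) W` one
has `V*V = W* h^k (h^(k+2) W) = 0`, hence `V = 0`, and the exponent drops by one. -/
theorem mul_pow_eq_zero {B W : R} (k : ℕ) (h : (B * star B) ^ (k + 1) * W = 0) :
    B * star B * W = 0 := by
  induction k with
  | zero => simpa using h
  | succ k ih =>
    apply ih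
    apply hτ.eq_zero_of_star_mul_self
    have hs : star ((B * star B) ^ (k + 1)) = (B * star B) ^ (k + 1) := by simp
    rw [star_mul, hs, mul_assoc, ← mul_assoc _ _ W, ← pow_add,
      show k + 1 + (k + 1) = k + (k + 1 + 1) by ring, pow_add, mul_assoc _ _ W, h, mul_zero,
      mul_zero]

theorem star_mul_eq_zero {B W : R} (h : B * star B * W = 0) : star B * W = 0 := by
  apply hτ.eq_zero_of_star_mul_self
  rw [star_mul, star_star, mul_assoc, ← mul_assoc B, h, mul_zero]

theorem mul_star_mul_eq_zero {Z B : R} (h : Z * star B * B = 0) : Z * star B = 0 := by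
  have : star B * (B * star Z) = 0 := by
    simpa [mul_assoc] using congrArg star h
  have h2 := hτ.star_mul_eq_zero (B := star B) (W := star Z) (by simpa [mul_assoc] using this)
  simpa using congrArg star h2

/-- The trace is that of `Y*Y`, where `Y = (BB*)^j W` if `m = 2j` and `Y = B*(BB*)^j W` if `m = 2j +
1`. Faithfulness gives `Y = 0`, and the powers of `BB*` can be removed. This is the tool that turns
trace identities into identities of operators. -/
theorem cancel {B W : R} (m : ℕ) (h : τ (star W * (B * star B) ^ m * W) = 0) :
    star B * W = 0 := by
  have hs (j : ℕ) : star ((B * star B) ^ j) = (B * star B) ^ j := by simp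
  apply hτ.star_mul_eq_zero
  rcases Nat.even_or_odd' m with ⟨j, rfl | rfl⟩
  · have : (B * star B) ^ j * W = 0 := by
      apply hτ.faithful
      rw [star_mul, hs, ← h, two_mul, pow_add]
      simp only [mul_assoc]
    cases j with
    | zero => rw [mul_assoc, ← one_mul W, ← pow_zero (B * star B), this, mul_zero, mul_zero]
    | succ j => exact hτ.mul_pow_eq_zero j this
  · have : star B * ((B * star B) ^ j * W) = 0 := by
      apply hτ.faithful
      rw [star_mul, star_mul, star_star, hs, ← h, two_mul, pow_succ, pow_add]
      simp only [mul_assoc, (Commute.refl (B * star B)).pow_left j |>.eq]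
    apply hτ.mul_pow_eq_zero j
    rw [pow_succ', mul_assoc, mul_assoc, this, mul_zero]

theorem pow_ne_zero {B : R} (hB : B ≠ 0) (m : ℕ) : τ ((B * star B) ^ (m + 1)) ≠ 0 := by
  intro h
  apply hB
  apply hτ.eq_zero_of_star_mul_self
  apply hτ.cancel m
  rw [mul_assoc, hτ.comm, mul_assoc, ← pow_succ, h]

/-- Orthogonality from a vanishing four-term trace. -/
theorem mul_star_eq_zero {B C : R} (m : ℕ)
    (h : τ (B * star C * (C * star B) * (B * star B) ^ m) = 0) : B * star C = 0 := by
  have h1 := hτ.cancel (B := B) (W := B * star C) m (by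
    rw [hτ.comm, ← mul_assoc, ← h, star_mul, star_star])
  have := congrArg star h1
  simp only [star_mul, star_star, star_zero] at this
  have h2 := hτ.mul_star_mul_eq_zero this
  simpa using congrArg star h2

/-- Equality of positive elements from equal mixed moments. -/
theorem mul_star_eq {B C : R} (m : ℕ) (D : ℂ)
    (h1 : τ ((B * star B) ^ (m + 2)) = D)
    (h2 : τ (C * star C * (B * star B) ^ (m + 1)) = D)
    (h3 : τ (C * star C * (C * star C) * (B * star B) ^ m) = D)
    (k1 : τ ((C * star C) ^ (m + 2)) = D)
    (k2 : τ (B * star B * (C * star C) ^ (m + 1)) = D)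
    (k3 : τ (B * star B * (B * star B) * (C * star C) ^ m) = D) :
    C * star C = B * star B := by
  -- The three moments give `τ((CC* - BB*)² (BB*)^m) = D - 2D + D = 0`.
  have key (B C : R) (h1 : τ ((B * star B) ^ (m + 2)) = D)
      (h2 : τ (C * star C * (B * star B) ^ (m + 1)) = D)
      (h3 : τ (C * star C * (C * star C) * (B * star B) ^ m) = D) :
      B * star B * (C * star C - B * star B) = 0 := by
    rw [mul_assoc, hτ.cancel (W := C * star C - B * star B) m, mul_zero]
    have hs : star (C * star C - B * star B) = C * star C - B * star B := by simp
    rw [hs, hτ.comm, ← mul_assoc]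
    have : (C * star C - B * star B) * (C * star C - B * star B) * (B * star B) ^ m =
        C * star C * (C * star C) * (B * star B) ^ m - C * star C * (B * star B) ^ (m + 1)
          - B * star B * (C * star C * (B * star B) ^ m) + (B * star B) ^ (m + 2) := by
      rw [show m + 2 = m + 1 + 1 from rfl, pow_succ' _ (m + 1), pow_succ' _ m]
      noncomm_ring
    rw [this, map_add, map_sub, map_sub, hτ.comm (B * star B), mul_assoc _ ((B * star B) ^ m),
      ← pow_succ, h1, h2, h3]
    ring
  have e1 := key B C h1 h2 h3
  have e2 := key C B k1 k2 k3
  -- The difference is annihilated by both positive elements, hence by itself.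
  have : (C * star C - B * star B) * (C * star C - B * star B) = 0 := by
    have e3 : C * star C * (C * star C - B * star B) = 0 := by
      rw [← neg_sub, mul_neg, e2, neg_zero]
    rw [sub_mul, e1, e3, sub_zero]
  have hs : star (C * star C - B * star B) = C * star C - B * star B := by simp
  rw [← sub_eq_zero]
  exact hτ.eq_zero_of_star_mul_self (by rw [hs, this])

/-- Equality in the Cauchy-Schwarz inequality for a family of elements with common absolute
values. -/
theorem eq_smul_of_trace_eq [StarModule ℂ R] {ι : Type*} {A : ι → R} {ρ σ : R}
    (hρ : ∀ x, A x * star (A x) = ρ) (hσ : ∀ x, star (A x) * A x = σ) (a b c d : ι) (m : ℕ) (l : ℂ)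
    (hl : l * star l = 1)
    (h : τ (A a * star (A b) * (A c * star (A d)) * ρ ^ m) = l * τ (ρ ^ (m + 2))) :
    A a * star (A b) = l • (A d * star (A c)) := by
  have hρs : star ρ = ρ := by rw [← hρ a]; simp
  have hD : star (τ (ρ ^ (m + 2))) = τ (ρ ^ (m + 2)) := by
    rw [← hτ.map_star, star_pow, hρs]
  have comm1 (x : ι) : A x * σ = ρ * A x := by rw [← hρ x, ← hσ x, mul_assoc]
  have comm2 (x : ι) : σ * star (A x) = star (A x) * ρ := by rw [← hρ x, ← hσ x, mul_assoc]
  have comm (x y : ι) : Commute (A x * star (A y)) ρ := by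
    rw [Commute, SemiconjBy, mul_assoc, ← comm2, ← mul_assoc, comm1, mul_assoc]
  -- All products `A_x A_y*` have absolute value `ρ` and commute with `ρ`, so `X` and `Y` have the
  -- same norm for the form `τ(X* ρ^m Y)`.
  have sq (x y : ι) : star (A x * star (A y)) * (A x * star (A y)) = ρ ^ 2 := by
    calc star (A x * star (A y)) * (A x * star (A y))
        = A y * (star (A x) * A x) * star (A y) := by rw [star_mul, star_star]; noncomm_ring
      _ = ρ ^ 2 := by rw [hσ, comm1, mul_assoc, hρ, sq]
  set X := A a * star (A b) with hX
  set Y := A d * star (A c) with hY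
  have hYs : star Y = A c * star (A d) := by rw [hY, star_mul, star_star]
  rw [← hYs] at h
  have hYX : τ (star Y * ρ ^ m * X) = l * τ (ρ ^ (m + 2)) := by
    rw [hτ.comm, ← mul_assoc, h]
  have hXY : τ (star X * ρ ^ m * Y) = star l * τ (ρ ^ (m + 2)) := by
    have := congrArg star hYX
    rw [← hτ.map_star] at this
    simp only [star_mul, star_star, star_pow, hρs, hD] at this
    rw [mul_assoc, this, mul_comm]
  have hXX : τ (star X * ρ ^ m * X) = τ (ρ ^ (m + 2)) := by
    rw [mul_assoc, ← ((comm a b).pow_right m).eq, ← mul_assoc, sq, ← pow_add, add_comm]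
  have hYY : τ (star Y * ρ ^ m * Y) = τ (ρ ^ (m + 2)) := by
    rw [mul_assoc, ← ((comm d c).pow_right m).eq, ← mul_assoc, sq, ← pow_add, add_comm]
  -- The squared norm of `X - lY` is `(1 - l l*) τ(ρ^(m+2)) = 0`; writing `ρ = A_x A_x*` with an
  -- arbitrary `x` removes the weight.
  have hW (x : ι) : star (A x) * (X - l • Y) = 0 := by
    apply hτ.cancel m
    rw [hρ]
    have : star (X - l • Y) * ρ ^ m * (X - l • Y) = star X * ρ ^ m * X - l • (star X * ρ ^ m * Y)
        - star l • (star Y * ρ ^ m * X) + (star l * l) • (star Y * ρ ^ m * Y) := by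
      rw [star_sub, star_smul]
      simp only [sub_mul, mul_sub, smul_mul_assoc, mul_smul_comm, smul_sub, smul_smul,
        mul_comm l (star l)]
      abel
    rw [this, map_add, map_sub, map_sub, map_smul, map_smul, map_smul, hXX, hXY, hYX, hYY]
    simp only [smul_eq_mul]
    linear_combination (-τ (ρ ^ (m + 2))) * hl
  -- The adjoint of `X - lY` is a combination of left multiples of `A_a*` and `A_d*`, which both
  -- annihilate `X - lY`.
  rw [← sub_eq_zero]
  apply hτ.eq_zero_of_star_mul_self
  rw [star_sub, star_smul, hX, hY, star_mul, star_mul, star_star, star_star, sub_mul,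
    smul_mul_assoc,
    mul_assoc, mul_assoc, ← hX, ← hY, hW, hW, mul_zero, mul_zero, smul_zero, sub_zero]

end IsFaithfulTrace

end Trace

/-! ### Products of Weyl families -/

section Weyl

variable {p n : ℕ} [NeZero p] {R : Type*} [Ring R] [Algebra ℂ R]

/-- Each multiplication merges two labels, splits off a factor `V 0`, which commutes with
everything, and adds a phase. By bilinearity the phases accumulate to `altSum`. -/
theorem prod_weyl (c : ZMod p) (V : Loop p → R)
    (hV : ∀ u v, V u * V v = phase (c * cross u v) • (V 0 * V (u + v))) (n : ℕ)
    (t : Fin (2 * (n + 1)) → Loop p) :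
    (List.ofFn fun i : Fin (n + 1) =>
        phase (c * cross (t (ket i)) (t (bra i))) • V (t (ket i) + t (bra i))).prod =
      phase (c * altSum t) • (V 0 ^ n * V (∑ k, t k)) := by
  have hcomm (u : Loop p) : V u * V 0 = V 0 * V u := by
    rw [hV, cross_zero_right, mul_zero, phase_zero, one_smul, add_zero]
  induction n with
  | zero =>
    have h1 : ∑ k, t k = t (ket 0) + t (bra 0) := by rw [sum_layer]; simp
    have h2 : altSum t = cross (t (ket 0)) (t (bra 0)) := by
      refine (altSum_succ (m := 1) t).trans ?_
      rw [altSum_succ]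
      simp [altSum, cross_zero_right]
      rfl
    rw [h1, h2]
    simp
  | succ n ih =>
    let t' : Fin (2 * (n + 1)) → Loop p := fun k => t ⟨k.1 + 2, by have := k.2; omega⟩
    have hk (i : Fin (n + 1)) : t (ket i.succ) = t' (ket i) := rfl
    have hb (i : Fin (n + 1)) : t (bra i.succ) = t' (bra i) := rfl
    have hs : ∑ k, t k = t (ket 0) + t (bra 0) + ∑ k, t' k := by
      rw [sum_layer, sum_layer, Fin.sum_univ_succ]
      rfl
    -- The ordered pairs are those inside the first replica, those between it and the rest, and
    -- those inside the rest.
    have ha : altSum t = cross (t (ket 0)) (t (bra 0)) + cross (t (ket 0) + t (bra 0)) (∑ k, t' k)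
        + altSum t' := by
      refine (altSum_succ (m := 2 * (n + 1) + 1) t).trans ?_
      rw [altSum_succ, Fin.sum_univ_succ]
      have e1 : t (Fin.succ (0 : Fin (2 * (n + 1) + 1))) = t (bra 0) := rfl
      have e2 : (fun i : Fin (2 * (n + 1)) => t (Fin.succ (Fin.succ i))) = t' := rfl
      have e3 : t (0 : Fin (2 * (n + 1) + 1 + 1)) = t (ket 0) := rfl
      simp only [e1, e2, e3, cross_add_left, cross_add_right]
      have e4 : ∑ i : Fin (2 * (n + 1)), t (Fin.succ (Fin.succ i)) = ∑ k, t' k := rfl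
      ring
    rw [List.ofFn_succ, List.prod_cons]
    simp only [hk, hb]
    rw [ih t', hs, ha, smul_mul_smul_comm, ← mul_assoc]
    have hpow (u : Loop p) : V u * V 0 ^ n = V 0 ^ n * V u :=
      ((show Commute (V u) (V 0) from hcomm u).pow_right n).eq
    rw [hpow, mul_assoc, hV, mul_smul_comm, smul_smul, ← mul_assoc, ← pow_succ, mul_add c,
      mul_add c, phase_add, phase_add]
    congr 1
    ring

end Weyl

/-! ### Values of the alternating functions -/

section Values

variable {p n : ℕ}

theorem SPTOrder.χ_nsmul_left (S : SPTOrder p n) (k : ℕ) (a b : S.G) :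
    S.χ (k • a) b = S.χ a b ^ k := by
  have h0 : S.χ 0 b = 1 := by
    have := S.χ_add_left 0 0 b
    rwa [add_zero, left_eq_mul] at this
  induction k with
  | zero => rw [zero_smul, h0, pow_zero]
  | succ k ih => rw [succ_nsmul, S.χ_add_left, ih, pow_succ]

theorem SPTOrder.χ_nsmul_right (S : SPTOrder p n) (k : ℕ) (a b : S.G) :
    S.χ a (k • b) = S.χ a b ^ k := by
  have h0 : S.χ a 0 = 1 := by
    have := S.χ_add_right a 0 0
    rwa [add_zero, left_eq_mul] at this
  induction k with
  | zero => rw [zero_smul, h0, pow_zero]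
  | succ k ih => rw [succ_nsmul, S.χ_add_right, ih, pow_succ]

theorem SPTOrder.χ_swap (S : SPTOrder p n) (a b : S.G) : S.χ b a = (S.χ a b)⁻¹ := by
  have := S.χ_self (a + b)
  rw [S.χ_add_left, S.χ_add_right, S.χ_add_right, S.χ_self, S.χ_self, one_mul, mul_one] at this
  exact eq_inv_of_mul_eq_one_right this

theorem exists_phase_eq [NeZero p] {z : ℂ} (hz : z ^ p = 1) : ∃ c : ZMod p, phase c = z := by
  obtain ⟨i, -, rfl⟩ := (Complex.isPrimitiveRoot_exp p (NeZero.ne p)).eq_pow_of_pow_eq_one hz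
  refine ⟨(i : ℤ), ?_⟩
  rw [phase, ZMod.stdAddChar_coe, ← Complex.exp_nat_mul]
  congr 1
  push_cast
  ring

theorem phase_pow [NeZero p] (c : ZMod p) (k : ℕ) : phase c ^ k = phase (c * (k : ZMod p)) := by
  rw [phase, ← AddChar.map_nsmul_eq_pow, nsmul_eq_mul, mul_comm]
  rfl

theorem nsmul_layer_eq_zero (g : LayerGroup p n) : p • g = 0 := by
  funext k
  simp

/-- The tensor of an SPT order on the layer configurations spanned by two elements of the group. -/
theorem SPTOrder.exists_tensor_eq_phase [NeZero p] (S : SPTOrder p n) {g₁ g₂ : LayerGroup p n}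
    (h₁ : g₁ ∈ S.G) (h₂ : g₂ ∈ S.G) :
    ∃ c : ZMod p, ∀ a b : Loop p,
      S.tensor (fun k => g₁ k • a + g₂ k • b) = phase (c * cross a b) := by
  -- The group has exponent `p`, so `χ` takes values in the `p`-th roots of unity.
  obtain ⟨c, hc⟩ := exists_phase_eq (p := p) (z := S.χ ⟨g₁, h₁⟩ ⟨g₂, h₂⟩) (by
    rw [← Units.val_pow_eq_pow_val, ← S.χ_nsmul_left]
    have : p • (⟨g₁, h₁⟩ : S.G) = 0 := Subtype.ext (nsmul_layer_eq_zero g₁)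
    rw [this, ← zero_smul ℕ (⟨g₁, h₁⟩ : S.G), S.χ_nsmul_left, pow_zero, Units.val_one])
  refine ⟨c, fun a b => ?_⟩
  -- On combinations of `g₁` and `g₂`, an alternating form is its value at `(g₁, g₂)` raised to the
  -- determinant of the coefficients, here `a × b`.
  have key := S.tensor_of_mem (a.1.val • ⟨g₁, h₁⟩ + b.1.val • ⟨g₂, h₂⟩)
    (a.2.val • ⟨g₁, h₁⟩ + b.2.val • ⟨g₂, h₂⟩)
  have hval (x : ZMod p) (y : ZMod p) : x.val • y = y * x := by
    rw [nsmul_eq_mul, ZMod.natCast_zmod_val, mul_comm]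
  have ht : (fun k => g₁ k • a + g₂ k • b) = fun k =>
      ((a.1.val • (⟨g₁, h₁⟩ : S.G) + b.1.val • ⟨g₂, h₂⟩ : S.G).1 k,
        (a.2.val • (⟨g₁, h₁⟩ : S.G) + b.2.val • ⟨g₂, h₂⟩ : S.G).1 k) := by
    funext k
    simp only [AddSubgroup.coe_add, AddSubgroup.coe_nsmul, Pi.add_apply, Pi.smul_apply, hval]
    rfl
  rw [ht, key]
  simp only [S.χ_add_left, S.χ_add_right, S.χ_nsmul_left, S.χ_nsmul_right, S.χ_self,
    S.χ_swap ⟨g₁, h₁⟩ ⟨g₂, h₂⟩, one_pow, one_mul, mul_one, Units.val_mul, Units.val_pow_eq_pow_val,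
    Units.val_inv_eq_inv_val, ← hc]
  have hinv : (phase c)⁻¹ = phase (-c) :=
    inv_eq_of_mul_eq_one_right (by rw [← phase_add, add_neg_cancel, phase_zero])
  rw [hinv, ← pow_mul, ← pow_mul, phase_pow, phase_pow, ← phase_add]
  congr 1
  simp only [Nat.cast_mul, ZMod.natCast_zmod_val, cross]
  ring

theorem SPTOrder.tensor_smul [NeZero p] (S : SPTOrder p n) {g : LayerGroup p n} (hg : g ∈ S.G)
    (x : Loop p) : S.tensor (fun k => g k • x) = 1 := by
  obtain ⟨c, hc⟩ := S.exists_tensor_eq_phase hg hg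
  simpa [cross_zero_right, phase_zero] using hc x 0

theorem SPTOrder.exists_phase_of_tensor_ne_zero [NeZero p] (S : SPTOrder p n)
    {t : Fin (2 * n) → Loop p} (ht : S.tensor t ≠ 0) : ∃ c : ZMod p, S.tensor t = phase c := by
  rw [S.tensor_ne_zero_iff] at ht
  obtain ⟨c, hc⟩ := S.exists_tensor_eq_phase ht.1 ht.2
  refine ⟨_, Eq.trans (congrArg S.tensor ?_) (hc (1, 0) (0, 1))⟩
  funext k
  ext <;> simp

/-- The SPT order with all layers shifted by one. -/
def SPTOrder.rotate (S : SPTOrder p n) : SPTOrder p n where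
  G :=
    { carrier := {g | g ∘ (finRotate (2 * n)).symm ∈ S.G}
      add_mem' := fun ha hb => S.G.add_mem ha hb
      zero_mem' := S.G.zero_mem
      neg_mem' := fun ha => S.G.neg_mem ha }
  χ a b := S.χ ⟨_, a.2⟩ ⟨_, b.2⟩
  χ_add_left a b c := S.χ_add_left ⟨_, a.2⟩ ⟨_, b.2⟩ ⟨_, c.2⟩
  χ_add_right a b c := S.χ_add_right ⟨_, a.2⟩ ⟨_, b.2⟩ ⟨_, c.2⟩
  χ_self a := S.χ_self ⟨_, a.2⟩

theorem SPTOrder.rotate_tensor (S : SPTOrder p n) (t : Fin (2 * n) → Loop p) :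
    S.rotate.tensor t = S.tensor (t ∘ (finRotate (2 * n)).symm) := rfl

theorem SPTOrder.adj_mem_rotate (S : SPTOrder p n) (k : Fin (2 * n)) :
    adj k ∈ S.rotate.G ↔ adj (finRotate (2 * n) k) ∈ S.G := by
  have : adj (p := p) (finRotate (2 * n) k) = adj k ∘ (finRotate (2 * n)).symm := by
    rw [← adj_comp_rotate k, Function.comp_assoc, Equiv.self_comp_symm, Function.comp_id]
  rw [this]
  rfl

end Values

/-! ### Replica traces -/

section Replica

variable {p n : ℕ} {R : Type*} [Ring R] [StarRing R] [Algebra ℂ R] {τ : R →ₗ[ℂ] ℂ}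

/-- The trace of the cyclic product of the operators `A_t` and their adjoints over all layers. -/
def replica (τ : R →ₗ[ℂ] ℂ) (A : Loop p → R) (n : ℕ) (t : Fin (2 * n) → Loop p) : ℂ :=
  τ (List.ofFn fun i : Fin n => A (t (ket i)) * star (A (-t (bra i)))).prod

/-- The family of adjoint operators. -/
def dual (A : Loop p → R) (x : Loop p) : R := star (A (-x))

omit [Algebra ℂ R] in
theorem dual_dual (A : Loop p → R) : dual (dual A) = A := by
  funext x
  simp [dual]

theorem prod_ofFn_regroup {M : Type*} [Monoid M] (k : ℕ) (a b : Fin (k + 1) → M) :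
    (List.ofFn fun i => a i * b i).prod =
      a 0 * (List.ofFn fun i : Fin k => b i.castSucc * a i.succ).prod * b (Fin.last k) := by
  induction k with
  | zero => simp
  | succ k ih =>
    rw [List.ofFn_succ, List.prod_cons, ih, List.ofFn_succ (n := k), List.prod_cons]
    simp only [mul_assoc]
    rfl

theorem IsFaithfulTrace.prod_rotate (hτ : IsFaithfulTrace τ) (a b : Fin n → R) :
    τ (List.ofFn fun i => a i * b i).prod =
      τ (List.ofFn fun i => b i * a (finRotate n i)).prod := by
  cases n with
  | zero => simp
  | succ k =>
    rw [prod_ofFn_regroup, mul_assoc, hτ.comm, List.ofFn_succ_last, List.prod_append, mul_assoc]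
    simp

/-- Cyclicity regroups the word: its first factor moves to the end, and the pairs `A A*` become
pairs `A* A`. Every statement about `A_x A_y*` thereby acquires a counterpart for `A_x* A_y`. -/
theorem IsFaithfulTrace.replica_dual (hτ : IsFaithfulTrace τ) (A : Loop p → R)
    (t : Fin (2 * n) → Loop p) :
    replica τ (dual A) n (t ∘ finRotate (2 * n)) = replica τ A n t := by
  rw [replica, replica, hτ.prod_rotate (fun i => A (t (ket i)))]
  simp only [Function.comp_apply, finRotate_ket, finRotate_bra, dual, neg_neg, star_star]

/-- The replica traces of `A` are proportional to the tensor of an SPT order. -/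
structure Realizes (τ : R →ₗ[ℂ] ℂ) (A : Loop p → R) (S : SPTOrder p n) (D : ℂ) : Prop where
  replica_eq : ∀ t, replica τ A n t = D * S.tensor t
  ne_zero : D ≠ 0

namespace Realizes

variable {A : Loop p → R} {S : SPTOrder p n} {D : ℂ}

theorem dual (h : Realizes τ A S D) (hτ : IsFaithfulTrace τ) :
    Realizes τ (dual A) S.rotate D where
  replica_eq t := by
    rw [S.rotate_tensor, ← h.replica_eq, ← hτ.replica_dual A, Function.comp_assoc,
      Equiv.symm_comp_self, Function.comp_id]
  ne_zero := h.ne_zero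

/-- Dualizing twice returns the family, and the tensor determines the order. This is the cyclic
symmetry of the replicas. -/
theorem rotate_rotate (h : Realizes τ A S D) (hτ : IsFaithfulTrace τ) : S.rotate.rotate = S := by
  apply SPTOrder.tensor_injective
  funext t
  have := (h.dual hτ).dual hτ
  rw [dual_dual] at this
  exact mul_left_cancel₀ h.ne_zero ((this.replica_eq t).symm.trans (h.replica_eq t))

theorem adj_ket_mem {m : ℕ} {S : SPTOrder p (m + 1)} (h : Realizes τ A S D)
    (hτ : IsFaithfulTrace τ) (h0 : adj (ket (0 : Fin (m + 1))) ∈ S.G) (i : Fin (m + 1)) :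
    adj (ket i) ∈ S.G := by
  induction i using Fin.induction with
  | zero => exact h0
  | succ i ih =>
    rw [← h.rotate_rotate hτ, SPTOrder.adj_mem_rotate, SPTOrder.adj_mem_rotate, finRotate_ket,
      finRotate_bra, finRotate_apply, Fin.coeSucc_eq_succ] at ih
    exact ih

theorem replica_ne_zero_iff (h : Realizes τ A S D) (t : Fin (2 * n) → Loop p) :
    replica τ A n t ≠ 0 ↔ S.tensor t ≠ 0 := by
  rw [h.replica_eq, mul_ne_zero_iff, and_iff_right h.ne_zero]

theorem replica_smul [NeZero p] (h : Realizes τ A S D) {g : LayerGroup p n} (hg : g ∈ S.G)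
    (x : Loop p) : replica τ A n (fun k => g k • x) = D := by
  rw [h.replica_eq, S.tensor_smul hg, mul_one]

/-- With the loops `x, -x, x, -x, …` the word is `(A_x A_x*)ⁿ`, whose trace cannot vanish. -/
theorem alternating_mem {m : ℕ} {S : SPTOrder p (m + 1)} (h : Realizes τ A S D)
    (hτ : IsFaithfulTrace τ) (hA : ∀ x, A x ≠ 0) : alternating p (m + 1) ∈ S.G := by
  have := (h.replica_ne_zero_iff fun k => alternating p (m + 1) k • ((1, 0) : Loop p)).mp (by
    simp only [replica, alternating_ket, alternating_bra, neg_smul, one_smul, neg_neg,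
      List.ofFn_const, List.prod_replicate]
    exact hτ.pow_ne_zero (hA _) m)
  simpa using ((S.tensor_ne_zero_iff _).mp this).1

theorem trace_pow [NeZero p] (h : Realizes τ A S D) :
    τ ((A 0 * star (A 0)) ^ n) = D := by
  rw [← h.replica_smul S.G.zero_mem 0]
  simp [replica]

end Realizes

theorem adj_bra_zero_ket {m : ℕ} (i : Fin (m + 2)) :
    adj (p := p) (bra (0 : Fin (m + 2))) (ket i) = if i = 1 then -1 else 0 := by
  rw [adj, finRotate_bra, finRotate_apply_zero, Pi.sub_apply, gen_apply, gen_apply,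
    if_neg (ket_ne_bra _ _), zero_sub]
  simp only [ket_injective.eq_iff]
  split_ifs <;> simp

theorem adj_bra_zero_bra {m : ℕ} (i : Fin (m + 2)) :
    adj (p := p) (bra (0 : Fin (m + 2))) (bra i) = if i = 0 then 1 else 0 := by
  rw [adj, finRotate_bra, Pi.sub_apply, gen_apply, gen_apply, if_neg (ket_ne_bra _ _).symm,
    sub_zero]
  simp only [bra_injective.eq_iff]

/-! ### Operator relations from the two adjacent generators -/

section Orders

variable {m : ℕ} {A : Loop p → R} {S : SPTOrder p (m + 2)} {D : ℂ}

theorem replica_add_two (t : Fin (2 * (m + 2)) → Loop p) :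
    replica τ A (m + 2) t = τ (A (t (ket 0)) * star (A (-t (bra 0))) *
      (A (t (ket 1)) * star (A (-t (bra 1)))) *
      (List.ofFn fun i : Fin m =>
        A (t (ket i.succ.succ)) * star (A (-t (bra i.succ.succ)))).prod) := by
  rw [replica, List.ofFn_succ, List.ofFn_succ, List.prod_cons, List.prod_cons, ← mul_assoc]
  rfl

theorem Realizes.mul_star_eq_zero [Fact p.Prime] (h : Realizes τ A S D) (hτ : IsFaithfulTrace τ)
    (hA : ∀ x, A x ≠ 0) (hb : adj (bra (0 : Fin (m + 2))) ∉ S.G) {x y : Loop p} (hxy : x ≠ y) :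
    A x * star (A y) = 0 := by
  apply hτ.mul_star_eq_zero m
  have halt := h.alternating_mem hτ hA
  by_contra hne
  -- This configuration is `x, -y, y, -x, x, -x, …`; its word is `A_x A_y* A_y A_x* (A_x A_x*)^m`.
  have := (h.replica_ne_zero_iff fun k => alternating p (m + 2) k • x +
      adj (p := p) (bra (0 : Fin (m + 2))) k • (x - y)).mp (by
    rw [replica_add_two]
    simp only [alternating_ket, alternating_bra, adj_bra_zero_ket, adj_bra_zero_bra]
    simpa [Fin.ext_iff] using hne)
  -- In a component where `x` and `y` differ, subtracting the alternating part and dividing by the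
  -- difference would place `adj (bra 0)` in the group.
  have key (c : ZMod p) (d : ZMod p) (hcd : c ≠ d)
      (hm : (fun k => alternating p (m + 2) k * c +
        adj (p := p) (bra (0 : Fin (m + 2))) k * (c - d)) ∈ S.G) :
      False := by
    apply hb
    have h1 := zmod_smul_mem S.G (c - d)⁻¹ (sub_mem hm (zmod_smul_mem S.G c halt))
    convert h1 using 1
    funext k
    have : c - d ≠ 0 := sub_ne_zero.mpr hcd
    simp only [Pi.smul_apply, Pi.sub_apply, smul_eq_mul]
    field_simp
    ring
  rw [S.tensor_ne_zero_iff] at this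
  rcases not_and_or.mp (fun h' => hxy (Prod.ext_iff.mpr h')) with h1 | h1
  · exact key _ _ h1 this.1
  · exact key _ _ h1 this.2

theorem Realizes.mul_star_eq [Fact p.Prime] (h : Realizes τ A S D) (hτ : IsFaithfulTrace τ)
    (hk : adj (ket (0 : Fin (m + 2))) ∈ S.G) (x : Loop p) :
    A x * star (A x) = A 0 * star (A 0) := by
  -- All elements `adj (ket j)` lie in the group, so each replica may carry its own multiple of `x`:
  -- `a` and `b` in the first two, `d` in the others. With values 0 and 1 these are the mixed
  -- moments needed.
  have key (a b d : ZMod p) : τ (A (a • x) * star (A (a • x)) * (A (b • x) * star (A (b • x))) *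
      (A (d • x) * star (A (d • x))) ^ m) = D := by
    let f : Fin (m + 2) → ZMod p := Fin.cons a (Fin.cons b fun _ => d)
    have hf : (∑ j, f j • adj (ket j)) ∈ S.G :=
      sum_mem fun j _ => zmod_smul_mem _ _ (h.adj_ket_mem hτ hk j)
    rw [← h.replica_smul hf x, replica_add_two]
    simp only [sum_smul_adj_ket_apply_ket, sum_smul_adj_ket_apply_bra, neg_smul, neg_neg]
    have h1 : f 1 = b := rfl
    have h2 (i : Fin m) : f i.succ.succ = d := rfl
    simp only [h1, h2, List.ofFn_const, List.prod_replicate]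
    rfl
  apply hτ.mul_star_eq m D
  · simpa [pow_succ', mul_assoc] using key 0 0 0
  · simpa [pow_succ', mul_assoc] using key 1 0 0
  · simpa [pow_succ', mul_assoc] using key 1 1 0
  · simpa [pow_succ', mul_assoc] using key 1 1 1
  · simpa [pow_succ', mul_assoc] using key 0 1 1
  · simpa [pow_succ', mul_assoc] using key 0 0 1

end Orders

/-! ### Classification -/

/-- The operators of a family behave like those of `X Z^{-c}`-dephasing. -/
structure WeylRelations [NeZero p] (c : ZMod p) (A : Loop p → R) : Prop where
  mul_star : ∀ x, A x * star (A x) = A 0 * star (A 0)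
  star_mul : ∀ x, star (A x) * A x = star (A 0) * A 0
  twist : ∀ a b, A a * star (A (-b)) = phase (c * cross a b) • (A 0 * star (A (-(a + b))))

/-- The relations between the operators of a family in each class. -/
def Case.Relations [NeZero p] (A : Loop p → R) : Case p → Prop
  | .case1 => (∀ x y, x ≠ y → A x * star (A y) = 0) ∧ ∀ x, A x * star (A x) = A 0 * star (A 0)
  | .case2 => (∀ x y, x ≠ y → A x * star (A y) = 0) ∧ ∀ x y, x ≠ y → star (A x) * A y = 0
  | .case3a => WeylRelations 0 A
  | .case3b c => WeylRelations (c : ZMod p) A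
  | .case4 => (∀ x y, x ≠ y → star (A x) * A y = 0) ∧ ∀ x, star (A x) * A x = star (A 0) * A 0

theorem case3_relations [Fact p.Prime] {A : Loop p → R} (c : ZMod p) :
    (case3 c).Relations A ↔ WeylRelations c A := by
  by_cases h : IsUnit c
  · rw [case3, dif_pos h]
    rfl
  · rw [case3, dif_neg h]
    rw [isUnit_iff_ne_zero, not_not] at h
    rw [h]
    rfl

/-- The second factor is rewritten by the twist relation so that it starts with `A_{-u}`; then
`A_{-u}* A_{-u}` may be replaced by `A_0* A_0`. -/
theorem WeylRelations.weyl [NeZero p] {c : ZMod p} {A : Loop p → R} (h : WeylRelations c A)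
    (u v : Loop p) : A 0 * star (A (-u)) * (A 0 * star (A (-v))) =
      phase (c * cross u v) • (A 0 * star (A (-0)) * (A 0 * star (A (-(u + v))))) := by
  have h1 := h.twist (-u) (u + v)
  rw [neg_add_cancel_left, cross_neg_left, cross_add_right, cross_self, zero_add] at h1
  have h2 : A 0 * star (A (-v)) = phase (c * cross u v) • (A (-u) * star (A (-(u + v)))) := by
    rw [h1, smul_smul, ← phase_add, mul_neg, add_neg_cancel, phase_zero, one_smul]
  rw [h2, mul_smul_comm, mul_assoc, ← mul_assoc (star (A (-u))), h.star_mul, neg_zero]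
  simp only [mul_assoc]

theorem WeylRelations.replica_eq [NeZero p] {c : ZMod p} {A : Loop p → R} (h : WeylRelations c A)
    (k : ℕ) (t : Fin (2 * (k + 1)) → Loop p) : replica τ A (k + 1) t = phase (c * altSum t) *
      τ ((A 0 * star (A 0)) ^ k * (A 0 * star (A (-∑ k, t k)))) := by
  have := prod_weyl c (fun u => A 0 * star (A (-u))) h.weyl k t
  simp only [← h.twist, neg_zero] at this
  rw [replica, this, map_smul, smul_eq_mul]

section Classification

variable {m : ℕ} {A : Loop p → R} {S : SPTOrder p (m + 2)} {D : ℂ}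

/-- This is the decomposition `(1, 0, -1) a + (0, 1, -1) b`, by which the tensor at a triangle is
governed by a single value of `χ`. -/
theorem triangle_eq (a b : Loop p) : triangle (m := m) a b = fun k =>
    (adj (p := p) (ket (0 : Fin (m + 2))) + adj (bra (0 : Fin (m + 2))) : LayerGroup p (m + 2)) k • a +
      adj (p := p) (bra (0 : Fin (m + 2))) k • b := by
  funext k
  revert k
  refine forall_layer (fun i => ?_) (fun i => ?_)
  · rw [Pi.add_apply, adj_bra_zero_ket, adj_ket, Pi.sub_apply, gen_apply, gen_apply,
      if_neg (ket_ne_bra _ _), sub_zero]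
    simp only [ket_injective.eq_iff]
    refine Fin.cases ?_ (fun i => Fin.cases ?_ (fun i => ?_) i) i
    · simp
      rfl
    · have : triangle (m := m) a b (ket 1) = -(a + b) := rfl
      simp [this, add_comm]
    · have : triangle (m := m) a b (ket i.succ.succ) = 0 := rfl
      simp [this, Fin.ext_iff]
  · rw [Pi.add_apply, adj_bra_zero_bra, adj_ket, Pi.sub_apply, gen_apply, gen_apply,
      if_neg (ket_ne_bra _ _).symm, zero_sub]
    simp only [bra_injective.eq_iff]
    refine Fin.cases ?_ (fun i => Fin.cases ?_ (fun i => ?_) i) i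
    · simp
      rfl
    · have : triangle (m := m) a b (bra 1) = 0 := rfl
      simp [this]
    · have : triangle (m := m) a b (bra i.succ.succ) = 0 := rfl
      simp [this]

theorem Realizes.exists_weylRelations [Fact p.Prime] [StarModule ℂ R] (h : Realizes τ A S D)
    (hτ : IsFaithfulTrace τ) (hk : adj (ket (0 : Fin (m + 2))) ∈ S.G)
    (hb : adj (bra (0 : Fin (m + 2))) ∈ S.G)
    (hρ : ∀ x, A x * star (A x) = A 0 * star (A 0))
    (hσ : ∀ x, star (A x) * A x = star (A 0) * A 0) : ∃ c : ZMod p, WeylRelations c A := by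
  obtain ⟨c, hc⟩ := S.exists_tensor_eq_phase (add_mem hk hb) hb
  refine ⟨c, hρ, hσ, fun a b => ?_⟩
  have h1 := h.replica_eq (triangle a b)
  rw [triangle_eq, hc, ← triangle_eq, replica_add_two] at h1
  -- The triangle word is `A_a A_{-b}* · A_{-(a+b)} A_0* · ρ^m`, with `ρ = A_0 A_0*` from the
  -- remaining replicas.
  apply hτ.eq_smul_of_trace_eq hρ hσ a (-b) (-(a + b)) 0 m _ (phase_mul_star _)
  rw [h.trace_pow, mul_comm, ← h1]
  have h2 (i : Fin m) : triangle (m := m) a b (ket i.succ.succ) = 0 := rfl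
  have h3 (i : Fin m) : triangle (m := m) a b (bra i.succ.succ) = 0 := rfl
  have h4 : triangle (m := m) a b (bra 1) = 0 := rfl
  simp only [h2, h3, h4, neg_zero, List.ofFn_const, List.prod_replicate]
  rfl

/-- The Weyl relations reduce every word to one at the total loop. If a nonzero total had a nonzero
tensor value, that value would be a phase, and equality in Cauchy–Schwarz would make `A_0 A_y*` a
multiple of `A_0 A_0*`, which `hA` forbids. -/
theorem Realizes.tensor_eq_case3 [Fact p.Prime] [StarModule ℂ R] (h : Realizes τ A S D)
    (hτ : IsFaithfulTrace τ) {c : ZMod p} (hc : WeylRelations c A)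
    (hA : ∀ y ≠ 0, ∀ l : ℂ, l ≠ 0 → A 0 * star (A y) ≠ l • (A 0 * star (A 0))) :
    S.tensor = (case3 c).tensor (m + 2) := by
  funext t
  have h1 := h.replica_eq t
  have hD := h.trace_pow
  rw [hc.replica_eq] at h1
  rw [case3_tensor, delta]
  split_ifs with h0
  · rw [h0, neg_zero, ← pow_succ, hD, mul_comm] at h1
    rw [one_mul, mul_left_cancel₀ h.ne_zero h1]
  · rw [zero_mul]
    by_contra hne
    obtain ⟨d, hd⟩ := S.exists_phase_of_tensor_ne_zero hne
    refine hA (-∑ k, t k) (neg_ne_zero.mpr h0) _ (phase_ne_zero (d - c * altSum t))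
      (hτ.eq_smul_of_trace_eq hc.mul_star hc.star_mul 0 _ 0 0 m _ (phase_mul_star _) ?_)
    rw [mul_assoc, ← pow_succ', hτ.comm, hD]
    apply mul_left_cancel₀ (phase_ne_zero (c * altSum t))
    rw [h1, hd, ← mul_assoc, ← phase_add, add_sub_cancel, mul_comm]

theorem replica_of_case1_relations [NeZero p] (hA : Case.case1.Relations A)
    (t : Fin (2 * n) → Loop p) :
    replica τ A n t = τ ((A 0 * star (A 0)) ^ n) * Case.case1.tensor n t := by
  classical
  simp only [Case.tensor, prod_delta]
  split_ifs with h
  · have (i : Fin n) : A (t (ket i)) * star (A (-t (bra i))) = A 0 * star (A 0) := by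
      rw [← eq_neg_of_add_eq_zero_left (h i), hA.2]
    simp [replica, this]
  · push Not at h
    obtain ⟨i, hi⟩ := h
    rw [replica, List.prod_eq_zero, map_zero, mul_zero]
    rw [List.mem_ofFn]
    exact ⟨i, hA.1 _ _ fun h' => hi (by rw [h', neg_add_cancel])⟩

theorem case1_tensor_rotate (t : Fin (2 * n) → Loop p) [NeZero p] :
    Case.case1.tensor n (t ∘ finRotate (2 * n)) = Case.case4.tensor n t := by
  simp only [Case.tensor, Function.comp_apply, finRotate_ket]

theorem case2_tensor (t : Fin (2 * n) → Loop p) [NeZero p] :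
    Case.case2.tensor n t = Case.case1.tensor n t * Case.case4.tensor n t := by
  simp only [Case.tensor, prod_layer, finRotate_ket]

theorem dual_relations_case1 [NeZero p] : Case.case1.Relations (dual A) ↔
    Case.case4.Relations A := by
  simp only [Case.Relations, dual, star_star, neg_zero]
  refine and_congr ⟨fun h x y hxy => ?_, fun h x y hxy => h _ _ fun h' => hxy (neg_injective h')⟩
    ⟨fun h x => ?_, fun h x => h _⟩
  · simpa using h (-x) (-y) fun h' => hxy (neg_injective h')
  · simpa using h (-x)

theorem replica_of_orthogonal (hA : ∀ x y, x ≠ y → A x * star (A y) = 0)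
    (t : Fin (2 * n) → Loop p) (h : replica τ A n t ≠ 0) (i : Fin n) :
    t (ket i) + t (bra i) = 0 := by
  by_contra hi
  apply h
  rw [replica, List.prod_eq_zero, map_zero]
  rw [List.mem_ofFn]
  exact ⟨i, hA _ _ fun h' => hi (by rw [h', neg_add_cancel])⟩

/-- The two orthogonality relations make each layer opposite to its successor, so supported
configurations are multiples of the alternating element; this lies in the group, and there the
tensor is 1. -/
theorem Realizes.tensor_eq_case2 [Fact p.Prime] (h : Realizes τ A S D)
    (hτ : IsFaithfulTrace τ) (hA0 : ∀ x, A x ≠ 0) (hA : Case.case2.Relations A) :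
    S.tensor = Case.case2.tensor (m + 2) := by
  classical
  funext t
  have key (h0 : S.tensor t ≠ 0) : ∀ k, t k + t (finRotate (2 * (m + 2)) k) = 0 := by
    have h1 := replica_of_orthogonal hA.1 t ((h.replica_ne_zero_iff t).mpr h0)
    have h2 := replica_of_orthogonal (τ := τ) (A := ToricCode.dual A) (fun x y hxy => by
      simpa [ToricCode.dual] using hA.2 _ _ fun h' => hxy (neg_injective h'))
      (t ∘ finRotate (2 * (m + 2))) (by
        rw [hτ.replica_dual]
        exact (h.replica_ne_zero_iff t).mpr h0)
    refine forall_layer (fun i => ?_) (fun i => ?_)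
    · rw [finRotate_ket]; exact h1 i
    · simpa only [Function.comp_apply, finRotate_ket] using h2 i
  simp only [Case.tensor, prod_delta]
  split_ifs with h1
  · have h2 : t = fun k => alternating p (m + 2) k • t (ket 0) := by
      have e1 := eq_smul_alternating (fun k => (t k).1) fun k => congrArg Prod.fst (h1 k)
      have e2 := eq_smul_alternating (fun k => (t k).2) fun k => congrArg Prod.snd (h1 k)
      funext k
      refine Prod.ext ?_ ?_
      · exact (congrFun e1 k).trans (mul_comm _ _)
      · exact (congrFun e2 k).trans (mul_comm _ _)
    rw [h2, S.tensor_smul (h.alternating_mem hτ hA0)]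
  · by_contra hne
    exact h1 (key hne)

/-- A family of operators realizing an SPT order belongs to one of the classes. -/
theorem Realizes.exists_case [Fact p.Prime] [StarModule ℂ R] (h : Realizes τ A S D)
    (hτ : IsFaithfulTrace τ) (hA0 : ∀ x, A x ≠ 0)
    (hA : ∀ y ≠ 0, ∀ l : ℂ, l ≠ 0 → A 0 * star (A y) ≠ l • (A 0 * star (A 0))) :
    ∃ κ : Case p, S.tensor = κ.tensor (m + 2) ∧ κ.Relations A := by
  have hd := h.dual hτ
  have hd0 (x : Loop p) : ToricCode.dual A x ≠ 0 := star_ne_zero.mpr (hA0 _)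
  -- One shift sends `bra 0` to `ket 1`; a further `m + 1` replica shifts lead from `ket 1` around
  -- the circle to `ket 0`.
  have hbd : adj (bra (0 : Fin (m + 2))) ∈ S.rotate.G ↔ adj (ket (0 : Fin (m + 2))) ∈ S.G := by
    have h1 : adj (ket (1 : Fin (m + 2))) ∈ S.G → adj (ket (0 : Fin (m + 2))) ∈ S.G := by
      intro h1
      have (i : ℕ) : adj (ket ((finRotate (m + 2))^[i] 1)) ∈ S.G := by
        induction i with
        | zero => exact h1
        | succ i ih =>
          rw [← h.rotate_rotate hτ, SPTOrder.adj_mem_rotate, SPTOrder.adj_mem_rotate, finRotate_ket,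
            finRotate_bra, ← Function.iterate_succ_apply' (finRotate (m + 2))] at ih
          exact ih
      have h2 := this (m + 1)
      rwa [show (finRotate (m + 2))^[m + 1] 1 = 0 by
        have : ⇑(finRotate (m + 2)) = fun i => i + 1 := funext fun i => finRotate_apply i
        rw [this, add_right_iterate]
        refine (succ_nsmul' (1 : Fin (m + 2)) (m + 1)).symm.trans ?_
        simpa using card_nsmul_eq_zero (x := (1 : Fin (m + 2)))] at h2
    rw [SPTOrder.adj_mem_rotate, finRotate_bra, finRotate_apply_zero]
    exact ⟨h1, fun h0 => h.adj_ket_mem hτ h0 1⟩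
  have hkd : adj (ket (0 : Fin (m + 2))) ∈ S.rotate.G ↔ adj (bra (0 : Fin (m + 2))) ∈ S.G := by
    rw [SPTOrder.adj_mem_rotate, finRotate_ket]
  have orth (hb : adj (bra (0 : Fin (m + 2))) ∉ S.G) (x y : Loop p) (hxy : x ≠ y) :=
    h.mul_star_eq_zero hτ hA0 hb hxy
  have orth' (hk : adj (ket (0 : Fin (m + 2))) ∉ S.G) (x y : Loop p) (hxy : x ≠ y) :
      star (A x) * A y = 0 := by
    have := hd.mul_star_eq_zero hτ hd0 (mt hbd.mp hk) (x := -x) (y := -y)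
      fun h' => hxy (neg_injective h')
    simpa [ToricCode.dual] using this
  have cst (hk : adj (ket (0 : Fin (m + 2))) ∈ S.G) := h.mul_star_eq hτ hk
  have cst' (hb : adj (bra (0 : Fin (m + 2))) ∈ S.G) (x : Loop p) :
      star (A x) * A x = star (A 0) * A 0 := by
    have := hd.mul_star_eq hτ (hkd.mpr hb) (-x)
    simpa [ToricCode.dual] using this
  by_cases hk : adj (ket (0 : Fin (m + 2))) ∈ S.G <;>
    by_cases hb : adj (bra (0 : Fin (m + 2))) ∈ S.G
  · obtain ⟨c, hc⟩ := h.exists_weylRelations hτ hk hb (cst hk) (cst' hb)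
    exact ⟨case3 c, h.tensor_eq_case3 hτ hc hA, (case3_relations c).mpr hc⟩
  · refine ⟨.case1, funext fun t => ?_, orth hb, cst hk⟩
    apply mul_left_cancel₀ h.ne_zero
    rw [← h.replica_eq, ← h.trace_pow, ← replica_of_case1_relations ⟨orth hb, cst hk⟩]
  · have hR : Case.case4.Relations A := ⟨orth' hk, cst' hb⟩
    refine ⟨.case4, funext fun t => ?_, hR⟩
    apply mul_left_cancel₀ h.ne_zero
    rw [← h.replica_eq, ← hd.trace_pow, ← hτ.replica_dual,
      replica_of_case1_relations (dual_relations_case1.mpr hR), case1_tensor_rotate]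
  · exact ⟨.case2, h.tensor_eq_case2 hτ hA0 ⟨orth hb, orth' hk⟩, orth hb, orth' hk⟩

end Classification

end Replica

/-! ### Unitaries from orthogonal families -/

section Unitary

variable {ι : Type*} [Fintype ι] [DecidableEq ι]

theorem exists_unit_mulVec {M : Matrix ι ι ℂ} (hM : M ≠ 0) :
    ∃ w, star (M *ᵥ w) ⬝ᵥ (M *ᵥ w) = 1 := by
  obtain ⟨v, hv⟩ : ∃ v, M *ᵥ v ≠ 0 := by
    by_contra! h
    exact hM (Matrix.ext_of_mulVec_single fun i => by rw [h, Matrix.zero_mulVec])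
  have hr := (Matrix.dotProduct_star_self_pos_iff (v := M *ᵥ v)).mpr hv
  set r := star (M *ᵥ v) ⬝ᵥ (M *ᵥ v) with hrdef
  have hre : 0 < r.re := (Complex.pos_iff.mp hr).1
  have hr' : r = (r.re : ℂ) := Complex.ext rfl (Complex.pos_iff.mp hr).2.symm
  refine ⟨((√r.re)⁻¹ : ℂ) • v, ?_⟩
  rw [Matrix.mulVec_smul, star_smul, smul_dotProduct, dotProduct_smul, ← hrdef, hr']
  simp only [smul_eq_mul, Complex.ofReal_re]
  have : star ((√r.re : ℂ)⁻¹) = (√r.re : ℂ)⁻¹ := by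
    rw [← Complex.ofReal_inv]; exact Complex.conj_ofReal _
  rw [this, ← Complex.ofReal_inv, ← Complex.ofReal_mul, ← Complex.ofReal_mul, Complex.ofReal_eq_one]
  nth_rewrite 3 [← Real.mul_self_sqrt hre.le]
  field_simp [(Real.sqrt_pos.mpr hre).ne']

omit [DecidableEq ι] in
theorem star_mulVec_dotProduct_mulVec (A B : Matrix ι ι ℂ) (v w : ι → ℂ) :
    star (A *ᵥ v) ⬝ᵥ (B *ᵥ w) = star v ⬝ᵥ ((Aᴴ * B) *ᵥ w) := by
  rw [Matrix.star_mulVec, Matrix.dotProduct_mulVec, Matrix.vecMul_vecMul, Matrix.dotProduct_mulVec]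

theorem of_columns_mem_unitaryGroup {u : ι → ι → ℂ}
    (hu : ∀ k l, star (u k) ⬝ᵥ u l = if k = l then 1 else 0) :
    (Matrix.of fun i k => u k i) ∈ Matrix.unitaryGroup ι ℂ := by
  rw [Matrix.mem_unitaryGroup_iff']
  ext k l
  rw [Matrix.one_apply, ← hu]
  rfl

/-- An orthogonal family of nonzero Hermitian matrices, as many as the dimension, consists of
multiples of the projections onto the vectors of an orthonormal basis. -/
theorem exists_unitary_of_orthogonal (P : ι → Matrix ι ι ℂ) (hH : ∀ k, (P k)ᴴ = P k)
    (h0 : ∀ k, P k ≠ 0) (horth : ∀ k l, k ≠ l → P k * P l = 0) :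
    ∃ U ∈ Matrix.unitaryGroup ι ℂ,
      ∀ k, P k = (P k).trace • (U * Matrix.single k k 1 * Uᴴ) := by
  choose w hw using fun k => exists_unit_mulVec (h0 k)
  let u : ι → ι → ℂ := fun k => P k *ᵥ w k
  have hPu (k l) (h : k ≠ l) : P k *ᵥ u l = 0 := by
    rw [Matrix.mulVec_mulVec, horth k l h, Matrix.zero_mulVec]
  have hu (k l) : star (u k) ⬝ᵥ u l = if k = l then 1 else 0 := by
    split_ifs with h
    · rw [← h]; exact hw k
    · rw [star_mulVec_dotProduct_mulVec, hH, horth k l h, Matrix.zero_mulVec, dotProduct_zero]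
  set U : Matrix ι ι ℂ := Matrix.of fun i k => u k i with hUdef
  have hU : U ∈ Matrix.unitaryGroup ι ℂ := of_columns_mem_unitaryGroup hu
  have h1 : U * Uᴴ = 1 := Matrix.mem_unitaryGroup_iff.mp hU
  have h2 : Uᴴ * U = 1 := Matrix.mem_unitaryGroup_iff'.mp hU
  refine ⟨U, hU, fun k => ?_⟩
  -- In the basis `u`, the matrix `P k` kills every `u l` with `l ≠ k`, and being Hermitian has no
  -- other rows either: only the entry `(k, k)` survives.
  have hM (i j) : (Uᴴ * P k * U) i j = star (u i) ⬝ᵥ (P k *ᵥ u j) := by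
    rw [Matrix.dotProduct_mulVec]
    rfl
  have hM' : Uᴴ * P k * U = ((Uᴴ * P k * U) k k) • Matrix.single k k 1 := by
    ext i j
    rw [Matrix.smul_apply, Matrix.single_apply]
    by_cases hj : k = j
    · by_cases hi : k = i
      · rw [if_pos ⟨hi, hj⟩, smul_eq_mul, mul_one, ← hi, ← hj]
      · rw [if_neg fun h => hi h.1, smul_zero, hM, Matrix.dotProduct_mulVec]
        have : star (u i) ᵥ* P k = star (P k *ᵥ u i) := by rw [Matrix.star_mulVec (P k), hH]
        rw [this, hPu k i hi, star_zero, zero_dotProduct]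
    · rw [if_neg fun h => hj h.2, smul_zero, hM, hPu k j hj, dotProduct_zero]
  have hP : P k = ((Uᴴ * P k * U) k k) • (U * Matrix.single k k 1 * Uᴴ) := by
    calc P k = U * Uᴴ * P k * (U * Uᴴ) := by rw [h1, one_mul, mul_one]
      _ = U * (Uᴴ * P k * U) * Uᴴ := by simp only [mul_assoc]
      _ = _ := by rw [hM', mul_smul_comm, smul_mul_assoc]; simp
  have ht : (P k).trace = (Uᴴ * P k * U) k k := by
    have := congrArg Matrix.trace hM'
    rw [Matrix.trace_mul_comm, ← mul_assoc, h1, one_mul, Matrix.trace_smul,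
      Matrix.trace_single_eq_same, smul_eq_mul, mul_one] at this
    exact this
  rw [ht]
  exact hP

/-- A system of matrix units of full size is unitarily equivalent to the standard one. -/
theorem exists_unitary_of_matrixUnits (q : ι → ι → Matrix ι ι ℂ) (hH : ∀ x y, (q x y)ᴴ = q y x)
    (o : ι) (h0 : q o o ≠ 0) (horth : ∀ x y z w, y ≠ z → q x y * q z w = 0)
    (hmul : ∀ x y w, q x y * q y w = q x w) :
    ∃ U ∈ Matrix.unitaryGroup ι ℂ, ∀ x y, q x y = U * Matrix.single x y 1 * Uᴴ := by
  obtain ⟨w, hw⟩ := exists_unit_mulVec h0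
  -- A unit vector in the range of `q o o` is transported by the `q x o` to an orthonormal basis.
  let v := q o o *ᵥ w
  let u : ι → ι → ℂ := fun x => q x o *ᵥ v
  have hqu (x y z) : q x y *ᵥ u z = if y = z then u x else 0 := by
    split_ifs with h
    · rw [← h, Matrix.mulVec_mulVec, hmul]
    · rw [Matrix.mulVec_mulVec, horth _ _ _ _ h, Matrix.zero_mulVec]
  have hu (k l) : star (u k) ⬝ᵥ u l = if k = l then 1 else 0 := by
    rw [star_mulVec_dotProduct_mulVec, hH]
    split_ifs with h
    · rw [h, hmul, Matrix.mulVec_mulVec, hmul]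
      exact hw
    · rw [horth _ _ _ _ h, Matrix.zero_mulVec, dotProduct_zero]
  set U : Matrix ι ι ℂ := Matrix.of fun i k => u k i with hUdef
  have hU : U ∈ Matrix.unitaryGroup ι ℂ := of_columns_mem_unitaryGroup hu
  refine ⟨U, hU, fun x y => ?_⟩
  have h1 : U * Uᴴ = 1 := Matrix.mem_unitaryGroup_iff.mp hU
  have h2 : q x y * U = U * Matrix.single x y 1 := by
    ext i z
    have e1 : (q x y * U) i z = (q x y *ᵥ u z) i := rfl
    rw [e1, hqu]
    split_ifs with h
    · rw [← h, Matrix.mul_single_apply_same, mul_one]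
      rfl
    · rw [Matrix.mul_single_apply_of_ne _ _ _ _ _ (Ne.symm h)]
      rfl
  rw [← h2, mul_assoc, h1, mul_one]

end Unitary

/-! ### Character sums and the explicit channels -/

section Channels

variable {p : ℕ} [Fact p.Prime]

theorem sum_phase_cross (a : Loop p) :
    ∑ s : Loop p, phase (cross s a) = if a = 0 then (p : ℂ) ^ 2 else 0 := by
  have key (b : ZMod p) : ∑ x : ZMod p, phase (x * b) = if b = 0 then (p : ℂ) else 0 := by
    have := AddChar.sum_mulShift b (ZMod.isPrimitive_stdAddChar p)
    rw [ZMod.card] at this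
    refine this.trans ?_
    split_ifs <;> simp
  rw [Fintype.sum_prod_type]
  have h1 (x y : ZMod p) : phase (cross (x, y) a) = phase (x * a.2) * phase (y * (-a.1)) := by
    rw [← phase_add]
    congr 1
    simp [cross]
    ring
  simp only [h1, ← Finset.mul_sum, ← Finset.sum_mul, key]
  by_cases h2 : a.1 = 0 <;> by_cases h3 : a.2 = 0 <;> simp [h2, h3, sq, Prod.ext_iff]

theorem sum_phase_cross' (a : Loop p) :
    ∑ s : Loop p, phase (cross a s) = if a = 0 then (p : ℂ) ^ 2 else 0 := by
  have := sum_phase_cross (-a)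
  simp only [cross_neg_right, ← cross_comm, neg_eq_zero] at this
  exact this

theorem natCast_sq_ne_zero : (p : ℂ) ^ 2 ≠ 0 :=
  pow_ne_zero 2 (Nat.cast_ne_zero.mpr (Fact.out : p.Prime).ne_zero)

/-- The Weyl operator `X^u Z^{cu}`. -/
noncomputable def weyl (c : ZMod p) (u : Loop p) : LogicalOp p :=
  Matrix.of fun i j => if i = u + j then phase (c * cross u j) else 0

theorem weyl_mul (c : ZMod p) (u v : Loop p) :
    weyl c u * weyl c v = phase (c * cross u v) • weyl c (u + v) := by
  ext i j
  rw [Matrix.mul_apply, Finset.sum_eq_single (v + j)]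
  · simp only [weyl, Matrix.of_apply, Matrix.smul_apply, if_true, add_assoc]
    split_ifs
    · rw [smul_eq_mul, ← phase_add, ← phase_add, cross_add_right, cross_add_left]
      congr 1
      ring
    · simp
  · intro k _ hk
    simp [weyl, hk]
  · simp

theorem weyl_zero (c : ZMod p) : weyl c 0 = 1 := by
  ext i j
  simp [weyl, Matrix.one_apply, cross_zero_left, phase_zero]

theorem trace_weyl (c : ZMod p) (u : Loop p) : (weyl c u).trace = (p : ℂ) ^ 2 * delta u := by
  rw [delta]
  split_ifs with h
  · rw [h, weyl_zero, Matrix.trace_one, Fintype.card_prod, ZMod.card]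
    push_cast
    ring
  · simp [Matrix.trace, weyl, h]

theorem loopX_mul_apply (s : Loop p) (M : LogicalOp p) (i j : Loop p) :
    (loopX s * M) i j = M (i - s) j := by
  rw [Matrix.mul_apply, Finset.sum_eq_single (i - s)]
  · simp [loopX]
  · intro k _ hk
    rw [loopX, Matrix.of_apply, if_neg, zero_mul]
    rintro rfl
    simp at hk
  · simp

theorem mul_loopX_apply (s : Loop p) (M : LogicalOp p) (i j : Loop p) :
    (M * loopX s) i j = M i (s + j) := by
  rw [Matrix.mul_apply, Finset.sum_eq_single (s + j)]
  · simp [loopX]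
  · intro k _ hk
    simp [loopX, hk]
  · simp

theorem dephaseXZ_apply (c : ZMod p) (ρ : LogicalOp p) (i j : Loop p) :
    dephaseXZ c ρ i j = ((p : ℂ) ^ 2)⁻¹ *
      ∑ r : Loop p, phase (-(c * cross r (i - j))) * ρ (i - r) (j - r) := by
  rw [dephaseXZ, Matrix.smul_apply, Matrix.sum_apply, smul_eq_mul]
  congr 1
  refine Finset.sum_congr rfl fun r _ => ?_
  rw [mul_loopX_apply, loopZ, loopZ, Matrix.mul_diagonal, Matrix.mul_assoc (loopX r),
    loopX_mul_apply,
    Matrix.diagonal_mul, neg_add_eq_sub, mul_right_comm, ← phase_add]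
  congr 2
  simp [cross]
  ring

theorem dephaseX_eq (ρ : LogicalOp p) : dephaseX ρ = dephaseXZ 0 ρ := by
  have : loopZ (0 : Loop p) = 1 := by
    rw [loopZ, ← Matrix.diagonal_one]
    congr 1
    funext t
    rw [cross_zero_left, phase_zero]
  simp [dephaseX, dephaseXZ, this]

/-- This exhibits the blocks of the dephasing channel as multiples of Weyl operators, the form in
which they are compared with the blocks of `Q`. -/
theorem dephaseXZ_eq_sum (c : ZMod p) (ρ : LogicalOp p) :
    dephaseXZ c ρ = ((p : ℂ) ^ 2)⁻¹ •
      ∑ s : Loop p, ∑ t : Loop p, ρ s t • phase (-(c * cross s t)) • weyl c (s - t) := by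
  ext i j
  rw [dephaseXZ_apply, Matrix.smul_apply, smul_eq_mul, Matrix.sum_apply]
  congr 1
  rw [← Equiv.sum_comp (Equiv.subLeft i)]
  refine Finset.sum_congr rfl fun s _ => ?_
  rw [Matrix.sum_apply, Finset.sum_eq_single (j - (i - s))]
  · simp only [Equiv.subLeft_apply, sub_sub_cancel, Matrix.smul_apply, weyl, Matrix.of_apply,
      smul_eq_mul]
    rw [if_pos (by abel), mul_comm, ← phase_add]
    congr 2
    simp [cross]
    ring
  · intro t _ ht
    rw [Matrix.smul_apply, Matrix.smul_apply, weyl, Matrix.of_apply, if_neg, smul_zero, smul_zero]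
    intro h
    apply ht
    rw [h]
    abel
  · simp

/-- The entry `(i, j)` is averaged against the character of `i - j`, which vanishes off the
diagonal. -/
theorem dephaseZ_eq (ρ : LogicalOp p) : dephaseZ ρ = Matrix.diagonal fun i => ρ i i := by
  ext i j
  rw [dephaseZ, Matrix.smul_apply, Matrix.sum_apply, smul_eq_mul]
  have (s : Loop p) : (loopZ s * ρ * loopZ (-s)) i j = ρ i j * phase (cross s (i - j)) := by
    rw [loopZ, loopZ, Matrix.mul_diagonal, Matrix.diagonal_mul, mul_right_comm, ← phase_add,
      mul_comm]
    congr 2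
    simp [cross]
    ring
  simp only [this, ← Finset.mul_sum, sum_phase_cross, sub_eq_zero]
  rw [Matrix.diagonal_apply]
  have := natCast_sq_ne_zero (p := p)
  split_ifs with h
  · rw [h, mul_comm, mul_assoc, mul_inv_cancel₀ this, mul_one]
  · simp

/-- The discrete Fourier transform on the logical space. -/
noncomputable def fourier (p : ℕ) [Fact p.Prime] : LogicalOp p :=
  Matrix.of fun i k => (p : ℂ)⁻¹ * phase (cross i k)

theorem fourier_mem_unitaryGroup : fourier p ∈ Matrix.unitaryGroup (Loop p) ℂ := by
  rw [Matrix.mem_unitaryGroup_iff]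
  ext i j
  rw [Matrix.star_eq_conjTranspose, Matrix.mul_apply, Matrix.one_apply]
  have (k : Loop p) : fourier p i k * (fourier p)ᴴ k j =
      ((p : ℂ) ^ 2)⁻¹ * phase (cross (i - j) k) := by
    rw [Matrix.conjTranspose_apply, fourier, Matrix.of_apply, Matrix.of_apply, star_mul, star_phase]
    have h1 : star ((p : ℂ)⁻¹) = (p : ℂ)⁻¹ := by simp
    rw [h1, sub_eq_add_neg, cross_add_left, cross_neg_left, phase_add]
    ring
  simp only [this, ← Finset.mul_sum, sum_phase_cross', sub_eq_zero]
  have := natCast_sq_ne_zero (p := p)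
  split_ifs with h
  · exact inv_mul_cancel₀ this
  · simp

theorem weyl_mul_fourier (a : Loop p) :
    weyl 0 a * fourier p = fourier p * Matrix.diagonal fun k => phase (-cross a k) := by
  have hw : weyl 0 a = loopX a := by
    ext i j
    simp [weyl, loopX, phase_zero]
  ext i k
  rw [hw, loopX_mul_apply, Matrix.mul_diagonal, fourier, Matrix.of_apply, Matrix.of_apply,
    sub_eq_add_neg, cross_add_left, cross_neg_left, phase_add, mul_assoc]

/-- Operators representing the group of loops with the traces of the regular representation. -/
theorem exists_unitary_of_weyl (V : Loop p → LogicalOp p) (hH : ∀ u, (V u)ᴴ = V (-u))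
    (hV : ∀ u v, V u * V v = V 0 * V (u + v)) (ht : ∀ u, (V u).trace = delta u) :
    ∃ U ∈ Matrix.unitaryGroup (Loop p) ℂ,
      ∀ u, V u = ((p : ℂ) ^ 2)⁻¹ • (U * weyl 0 u * Uᴴ) := by
  have hp := natCast_sq_ne_zero (p := p)
  -- The Fourier components of `V`: Hermitian, of trace `p⁻²`, and as many as the dimension.
  let P : Loop p → LogicalOp p := fun k => ((p : ℂ) ^ 2)⁻¹ • ∑ a, phase (cross a k) • V a
  have hPH (k) : (P k)ᴴ = P k := by
    simp only [P, Matrix.conjTranspose_smul, Matrix.conjTranspose_sum, star_phase, hH]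
    congr 1
    · simp
    · rw [← Equiv.sum_comp (Equiv.neg _)]
      simp [cross_neg_left]
  have hPt (k) : (P k).trace = ((p : ℂ) ^ 2)⁻¹ := by
    simp [P, Matrix.trace_sum, ht, delta, cross_zero_left, phase_zero]
  have hP0 (k) : P k ≠ 0 := by
    intro h
    have := hPt k
    rw [h, Matrix.trace_zero] at this
    exact inv_ne_zero hp this.symm
  have horth (k l) (hkl : k ≠ l) : P k * P l = 0 := by
    simp only [P]
    rw [smul_mul_smul_comm, Finset.sum_mul_sum]
    -- After the substitution `b = d - a`, the outer index enters only through the character of `k -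
    -- l`, whose sum vanishes for `k ≠ l`.
    have (a : Loop p) : ∑ b, phase (cross a k) • V a * phase (cross b l) • V b =
        phase (cross a (k - l)) • ∑ d, phase (cross d l) • (V 0 * V d) := by
      rw [← Equiv.sum_comp (Equiv.addLeft a), Finset.smul_sum]
      conv_rhs => rw [← Equiv.sum_comp (Equiv.addLeft a)]
      rw [← Equiv.sum_comp (Equiv.addLeft (-a))]
      refine Finset.sum_congr rfl fun d _ => ?_
      simp only [Equiv.coe_addLeft]
      rw [smul_mul_smul_comm, hV, smul_smul, ← phase_add, ← phase_add, add_neg_cancel_left]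
      congr 2
      simp [cross]
      ring
    simp only [this, ← Finset.sum_smul, sum_phase_cross, sub_eq_zero, if_neg hkl, zero_smul,
      smul_zero]
  obtain ⟨U, hU, hUP⟩ := exists_unitary_of_orthogonal P hPH hP0 horth
  have hF1 : fourier p * (fourier p)ᴴ = 1 :=
    Matrix.mem_unitaryGroup_iff.mp (fourier_mem_unitaryGroup (p := p))
  have hF2 : (fourier p)ᴴ * fourier p = 1 :=
    Matrix.mem_unitaryGroup_iff'.mp (fourier_mem_unitaryGroup (p := p))
  refine ⟨U * (fourier p)ᴴ, mul_mem hU (Unitary.star_mem fourier_mem_unitaryGroup), fun u => ?_⟩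
  -- Fourier inversion.
  have h1 : V u = ∑ k, phase (-cross u k) • P k := by
    simp only [P, Finset.smul_sum]
    rw [Finset.sum_comm]
    have (a : Loop p) : ∑ k, phase (-cross u k) • ((p : ℂ) ^ 2)⁻¹ • phase (cross a k) • V a =
        (((p : ℂ) ^ 2)⁻¹ * ∑ k, phase (cross (a - u) k)) • V a := by
      rw [Finset.mul_sum, Finset.sum_smul]
      refine Finset.sum_congr rfl fun k _ => ?_
      rw [smul_smul, smul_smul, sub_eq_add_neg, cross_add_left, phase_add, cross_neg_left]
      congr 1
      ring
    simp only [this, sum_phase_cross', sub_eq_zero]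
    simp [hp]
  have h2 : V u = ((p : ℂ) ^ 2)⁻¹ • (U * (Matrix.diagonal fun k => phase (-cross u k)) * Uᴴ) := by
    rw [h1, ← Matrix.sum_single_eq_diagonal, Finset.mul_sum, Finset.sum_mul, Finset.smul_sum]
    refine Finset.sum_congr rfl fun k _ => ?_
    rw [hUP, hPt, smul_comm]
    congr 1
    rw [← mul_one (phase _), ← smul_eq_mul, ← Matrix.smul_single, mul_smul_comm, smul_mul_assoc,
      smul_eq_mul, mul_one]
  have h3 : (Matrix.diagonal fun k => phase (-cross u k)) =
      (fourier p)ᴴ * weyl 0 u * fourier p := by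
    rw [mul_assoc, weyl_mul_fourier, ← mul_assoc, hF2, one_mul]
  rw [h2, h3, Matrix.conjTranspose_mul, Matrix.conjTranspose_conjTranspose]
  simp only [mul_assoc]

end Channels

/-! ### The trace on a family of matrix algebras -/

section WeightedTrace

variable {Θ J : Type*} [Fintype Θ] [Fintype J] [DecidableEq J]

/-- The weighted sum of the traces of a family of matrices. -/
noncomputable def weightedTrace (w : Θ → ℝ) : (Θ → Matrix J J ℂ) →ₗ[ℂ] ℂ where
  toFun f := ∑ θ, (w θ : ℂ) * (f θ).trace
  map_add' f g := by simp [mul_add, Finset.sum_add_distrib]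
  map_smul' c f := by
    simp only [Pi.smul_apply, Matrix.trace_smul, smul_eq_mul, Finset.mul_sum, RingHom.id_apply]
    exact Finset.sum_congr rfl fun _ _ => mul_left_comm _ _ _

omit [DecidableEq J] in
theorem weightedTrace_apply (w : Θ → ℝ) (f : Θ → Matrix J J ℂ) :
    weightedTrace w f = ∑ θ, (w θ : ℂ) * (f θ).trace := rfl

theorem isFaithfulTrace_weightedTrace {w : Θ → ℝ} (hw : ∀ θ, 0 < w θ) :
    IsFaithfulTrace (weightedTrace (J := J) w) where
  comm a b := Finset.sum_congr rfl fun θ _ => by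
    rw [Pi.mul_apply, Pi.mul_apply, Matrix.trace_mul_comm]
  map_star a := by
    rw [weightedTrace_apply, weightedTrace_apply, star_sum]
    refine Finset.sum_congr rfl fun θ _ => ?_
    rw [Pi.star_apply, Matrix.star_eq_conjTranspose, Matrix.trace_conjTranspose, star_mul']
    congr 1
    exact (Complex.conj_ofReal _).symm
  faithful a h := by
    change ∑ θ, (w θ : ℂ) * ((a θ)ᴴ * a θ).trace = 0 at h
    have hpos (θ : Θ) : (0 : ℂ) < w θ := Complex.zero_lt_real.mpr (hw θ)
    rw [Finset.sum_eq_zero_iff_of_nonneg fun θ _ => mul_nonneg (hpos θ).le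
      (Matrix.posSemidef_conjTranspose_mul_self (a θ)).trace_nonneg] at h
    funext θ
    have := (mul_eq_zero.mp (h θ (Finset.mem_univ θ))).resolve_left (hpos θ).ne'
    exact Matrix.trace_conjTranspose_mul_self_eq_zero_iff.mp this

end WeightedTrace

/-! ### Factorization of the blocks -/

section Blocks

variable {p n : ℕ}

/-- A rectangular matrix as the corner of a square matrix. -/
def corner {I K : Type*} (F : Matrix I K ℂ) : Matrix (I ⊕ K) (I ⊕ K) ℂ :=
  Matrix.fromBlocks 0 F 0 0

section Corner

variable {I K : Type*} [Fintype I] [Fintype K] [DecidableEq I] [DecidableEq K]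

theorem corner_mul_star (F G : Matrix I K ℂ) :
    corner F * star (corner G) = Matrix.fromBlocks (F * Gᴴ) 0 0 0 := by
  rw [corner, corner, Matrix.star_eq_conjTranspose, Matrix.fromBlocks_conjTranspose,
    Matrix.fromBlocks_multiply]
  simp

theorem star_corner_mul (F G : Matrix I K ℂ) :
    star (corner F) * corner G = Matrix.fromBlocks 0 0 0 (Fᴴ * G) := by
  rw [corner, corner, Matrix.star_eq_conjTranspose, Matrix.fromBlocks_conjTranspose,
    Matrix.fromBlocks_multiply]
  simp

theorem prod_fromBlocks (k : ℕ) (q : Fin (k + 1) → Matrix I I ℂ) :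
    (List.ofFn fun i => (Matrix.fromBlocks (q i) 0 0 0 : Matrix (I ⊕ K) (I ⊕ K) ℂ)).prod =
      Matrix.fromBlocks (List.ofFn q).prod 0 0 0 := by
  induction k with
  | zero => simp
  | succ k ih =>
    rw [List.ofFn_succ, List.prod_cons, ih, Matrix.fromBlocks_multiply, List.ofFn_succ (f := q),
      List.prod_cons]
    simp

end Corner

open scoped MatrixOrder in
-- With `Q = B*B`, the rows of `B*` are grouped by their input loop.
theorem exists_block_factorization {Q : ChoiMatrix p} [NeZero p] (hQ : Q.PosSemidef) :
    ∃ F : Loop p → Matrix (Loop p) (Loop p × Loop p) ℂ, ∀ s t, block Q s t = F s * (F t)ᴴ := by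
  obtain ⟨B, rfl⟩ := CStarAlgebra.nonneg_iff_eq_star_mul_self.mp hQ.nonneg
  refine ⟨fun s => Matrix.of fun i k => star (B k (i, s)), fun s t => ?_⟩
  ext i j
  simp [block, Matrix.star_eq_conjTranspose, Matrix.mul_apply]

theorem pi_prod_ofFn_apply {Θ M : Type*} [Monoid M] (k : ℕ) (f : Fin k → Θ → M) (θ : Θ) :
    (List.ofFn f).prod θ = (List.ofFn fun i => f i θ).prod := by
  induction k with
  | zero => simp
  | succ k ih =>
    rw [List.ofFn_succ, List.prod_cons, Pi.mul_apply, ih, List.ofFn_succ, List.prod_cons]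

/-- Products of the form `corner F * star (corner G)` live in the upper left block, so the trace on
the enlarged space is the original one. At least one factor is required, because an empty product
would be the larger identity. -/
theorem replica_corner {Θ : Type*} [Fintype Θ] [NeZero p] (Q : Θ → ChoiMatrix p)
    (F : Θ → Loop p → Matrix (Loop p) (Loop p × Loop p) ℂ)
    (hF : ∀ θ s t, block (Q θ) s t = F θ s * (F θ t)ᴴ) (w : Θ → ℝ) (k : ℕ)
    (t : Fin (2 * (k + 1)) → Loop p) :
    replica (weightedTrace w) (fun s θ => corner (F θ s)) (k + 1) t =
      ∑ θ, (w θ : ℂ) * replicaTrace (Q θ) t := by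
  rw [replica, weightedTrace_apply]
  refine Finset.sum_congr rfl fun θ _ => ?_
  rw [pi_prod_ofFn_apply]
  simp only [Pi.mul_apply, Pi.star_apply, corner_mul_star, ← hF]
  rw [prod_fromBlocks, replicaTrace]
  congr 1
  simp [Matrix.trace, Fintype.sum_sum_type]

theorem replicaTrace_zero [NeZero p] (Q : ChoiMatrix p) :
    replicaTrace Q (0 : Fin (2 * n) → Loop p) = ((block Q 0 0) ^ n).trace := by
  simp [replicaTrace]

theorem trace_block_self [NeZero p] {Q : ChoiMatrix p} (hQ : IsChannel Q) (s : Loop p) :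
    (block Q s s).trace = 1 := by
  rw [hQ.2, if_pos rfl]

theorem nonempty_syndrome [NeZero p] {Θ : Type*} [Fintype Θ] (E : LogicalEnsemble p Θ) :
    Nonempty Θ := by
  by_contra h
  rw [not_nonempty_iff] at h
  have := E.prob_sum
  simp at this

/-- The denominator is the trace of a power of `A_0 A_0*`, and `A_0 ≠ 0` because `q_{0,0}` has trace
1. -/
theorem denominator_ne_zero [NeZero p] {Θ : Type*} [Fintype Θ] (E : LogicalEnsemble p Θ) (k : ℕ) :
    ∑ θ, (E.prob θ : ℂ) ^ (k + 1) * ((block (E.choi θ) 0 0) ^ (k + 1)).trace ≠ 0 := by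
  choose F hF using fun θ => exists_block_factorization (E.isChannel θ).1
  have hw (θ : Θ) : 0 < E.prob θ ^ (k + 1) := pow_pos (E.prob_pos θ) _
  have h1 := replica_corner E.choi F hF (fun θ => E.prob θ ^ (k + 1)) k 0
  simp only [replicaTrace_zero, Complex.ofReal_pow] at h1
  rw [← h1, replica]
  simp only [Pi.zero_apply, neg_zero, List.ofFn_const, List.prod_replicate]
  refine (isFaithfulTrace_weightedTrace hw).pow_ne_zero (fun h => ?_) k
  obtain ⟨θ⟩ := nonempty_syndrome E
  have h2 := congrFun h θ
  have h3 : F θ 0 = 0 := by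
    have := congrArg Matrix.toBlocks₁₂ h2
    exact this
  have h4 := trace_block_self (E.isChannel θ) 0
  rw [hF, h3, Matrix.zero_mul, Matrix.trace_zero] at h4
  exact zero_ne_one h4

/-- The classification of solutions, together with the relations between the blocks. -/
theorem exists_case_of_expectation [Fact p.Prime] {Θ : Type*} [Fintype Θ]
    (E : LogicalEnsemble p Θ) (hn : 2 ≤ n) (S : SPTOrder p n) (h : E.expectation n = S.tensor) :
    ∃ κ : Case p, S.tensor = κ.tensor n ∧ ∀ θ,
      ∃ F : Loop p → Matrix (Loop p) (Loop p × Loop p) ℂ,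
        (∀ s t, block (E.choi θ) s t = F s * (F t)ᴴ) ∧ κ.Relations fun s => corner (F s) := by
  obtain ⟨m, rfl⟩ : ∃ m, n = m + 2 := ⟨n - 2, by omega⟩
  have : NeZero p := ⟨(Fact.out : p.Prime).ne_zero⟩
  choose F hF using fun θ => exists_block_factorization (E.isChannel θ).1
  have hw (θ : Θ) : 0 < E.prob θ ^ (m + 2) := pow_pos (E.prob_pos θ) _
  have hτ := isFaithfulTrace_weightedTrace (J := Loop p ⊕ (Loop p × Loop p)) hw
  have hD := denominator_ne_zero E (m + 1)
  obtain ⟨θ₀⟩ := nonempty_syndrome E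
  have hR : Realizes (weightedTrace fun θ => E.prob θ ^ (m + 2)) (fun s θ => corner (F θ s)) S
      (∑ θ, (E.prob θ : ℂ) ^ (m + 2) * ((block (E.choi θ) 0 0) ^ (m + 2)).trace) :=
    { replica_eq := fun t => by
        rw [replica_corner E.choi F hF _ (m + 1) t, ← h, LogicalEnsemble.expectation,
          mul_div_cancel₀ _ hD]
        simp only [Complex.ofReal_pow]
      ne_zero := hD }
  have hne (x : Loop p) : (fun θ => corner (F θ x)) ≠ 0 := by
    intro hx
    have h3 : F θ₀ x = 0 := by
      have := congrArg Matrix.toBlocks₁₂ (congrFun hx θ₀)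
      exact this
    have h4 := trace_block_self (E.isChannel θ₀) x
    rw [hF, h3, Matrix.zero_mul, Matrix.trace_zero] at h4
    exact zero_ne_one h4
  -- The two sides have different traces: `q_{0,y}` is traceless, `q_{0,0}` has trace 1.
  have hnp (y : Loop p) (hy : y ≠ 0) (l : ℂ) (hl : l ≠ 0) :
      (fun θ => corner (F θ 0)) * star (fun θ => corner (F θ y)) ≠
        l • ((fun θ => corner (F θ 0)) * star fun θ => corner (F θ 0)) := by
    intro hyl
    have h5 := congrFun hyl θ₀
    simp only [Pi.mul_apply, Pi.star_apply, Pi.smul_apply, corner_mul_star, ← hF] at h5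
    have h6 := congrArg (fun M => (Matrix.toBlocks₁₁ M).trace) h5
    simp only [Matrix.toBlocks_fromBlocks₁₁, Matrix.fromBlocks_smul, Matrix.trace_smul,
      (E.isChannel θ₀).2, if_neg hy.symm, if_true, smul_eq_mul, mul_one] at h6
    exact hl h6.symm
  obtain ⟨κ, hκ, hrel⟩ := hR.exists_case hτ hne hnp
  -- The relations are identities in a product of algebras, so they hold for each syndrome with the
  -- same class.
  refine ⟨κ, hκ, fun θ => ⟨F θ, hF θ, ?_⟩⟩
  cases κ with
  | case1 => exact ⟨fun x y hxy => congrFun (hrel.1 x y hxy) θ, fun x => congrFun (hrel.2 x) θ⟩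
  | case2 =>
    exact ⟨fun x y hxy => congrFun (hrel.1 x y hxy) θ, fun x y hxy => congrFun (hrel.2 x y hxy) θ⟩
  | case3a =>
    exact ⟨fun x => congrFun (hrel.mul_star x) θ, fun x => congrFun (hrel.star_mul x) θ,
      fun a b => congrFun (hrel.twist a b) θ⟩
  | case3b c =>
    exact ⟨fun x => congrFun (hrel.mul_star x) θ, fun x => congrFun (hrel.star_mul x) θ,
      fun a b => congrFun (hrel.twist a b) θ⟩
  | case4 => exact ⟨fun x y hxy => congrFun (hrel.1 x y hxy) θ, fun x => congrFun (hrel.2 x) θ⟩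

/-! ### Normal forms from the relations -/

section NormalForms

variable [Fact p.Prime] {Q : ChoiMatrix p} {F : Loop p → Matrix (Loop p) (Loop p × Loop p) ℂ}

theorem fromBlocks_left_injective {I K : Type*} {M N : Matrix I I ℂ}
    (h : (Matrix.fromBlocks M 0 0 0 : Matrix (I ⊕ K) (I ⊕ K) ℂ) = Matrix.fromBlocks N 0 0 0) :
    M = N :=
  (Matrix.fromBlocks_inj.mp h).1

theorem fromBlocks_right_injective {I K : Type*} {M N : Matrix K K ℂ}
    (h : (Matrix.fromBlocks 0 0 0 M : Matrix (I ⊕ K) (I ⊕ K) ℂ) = Matrix.fromBlocks 0 0 0 N) :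
    M = N :=
  (Matrix.fromBlocks_inj.mp h).2.2.2

theorem mul_conjTranspose_eq_zero (h : ∀ x y, x ≠ y → corner (F x) * star (corner (F y)) = 0)
    {x y : Loop p} (hxy : x ≠ y) : F x * (F y)ᴴ = 0 := by
  have := h x y hxy
  rw [corner_mul_star, ← Matrix.fromBlocks_zero] at this
  exact fromBlocks_left_injective this

theorem conjTranspose_mul_eq_zero (h : ∀ x y, x ≠ y → star (corner (F x)) * corner (F y) = 0)
    {x y : Loop p} (hxy : x ≠ y) : (F x)ᴴ * F y = 0 := by
  have := h x y hxy
  rw [star_corner_mul, ← Matrix.fromBlocks_zero] at this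
  exact fromBlocks_right_injective this

theorem block_conjTranspose (hF : ∀ s t, block Q s t = F s * (F t)ᴴ) (s t : Loop p) :
    (block Q s t)ᴴ = block Q t s := by
  rw [hF, hF, Matrix.conjTranspose_mul, Matrix.conjTranspose_conjTranspose]

theorem normalForm_case1 (hF : ∀ s t, block Q s t = F s * (F t)ᴴ)
    (h : Case.case1.Relations fun s => corner (F s)) : Case.case1.NormalForm Q := by
  intro ρ
  have h2 (x : Loop p) : block Q x x = block Q 0 0 := by
    have := h.2 x
    simp only [corner_mul_star] at this
    rw [hF, hF]
    exact fromBlocks_left_injective this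
  rw [applyChoi, Matrix.trace, Finset.sum_smul]
  refine Finset.sum_congr rfl fun s _ => ?_
  rw [Finset.sum_eq_single s, h2, Matrix.diag_apply]
  · intro t _ ht
    rw [hF, mul_conjTranspose_eq_zero h.1 ht.symm, smul_zero]
  · simp

/-- `q_{x,x} q_{y,y}` contains the factor `F_x† F_y`, so the diagonal blocks are orthogonal; the
unit traces normalize them to projections. -/
theorem exists_unitary_diag (hQ : IsChannel Q) (hF : ∀ s t, block Q s t = F s * (F t)ᴴ)
    (h : ∀ x y, x ≠ y → (F x)ᴴ * F y = 0) :
    ∃ U ∈ Matrix.unitaryGroup (Loop p) ℂ, ∀ x, block Q x x = U * Matrix.single x x 1 * Uᴴ := by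
  obtain ⟨U, hU, hP⟩ := exists_unitary_of_orthogonal (fun x => block Q x x)
    (fun x => block_conjTranspose hF x x) (fun x hx => by
      have := trace_block_self hQ x
      rw [hx, Matrix.trace_zero] at this
      exact zero_ne_one this) fun x y hxy => by
        rw [hF, hF, Matrix.mul_assoc, ← Matrix.mul_assoc _ (F y), h x y hxy, Matrix.zero_mul,
          Matrix.mul_zero]
  refine ⟨U, hU, fun x => ?_⟩
  rw [hP, trace_block_self hQ, one_smul]

theorem normalForm_case2 (hQ : IsChannel Q) (hF : ∀ s t, block Q s t = F s * (F t)ᴴ)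
    (h : Case.case2.Relations fun s => corner (F s)) : Case.case2.NormalForm Q := by
  obtain ⟨U, hU, hP⟩ := exists_unitary_diag hQ hF fun x y hxy => conjTranspose_mul_eq_zero h.2 hxy
  refine ⟨U, hU, fun ρ => ?_⟩
  rw [dephaseZ_eq, applyChoi, ← Matrix.sum_single_eq_diagonal, Finset.mul_sum, Finset.sum_mul]
  refine Finset.sum_congr rfl fun s _ => ?_
  rw [Finset.sum_eq_single s, hP, ← smul_mul_assoc, ← mul_smul_comm, Matrix.smul_single,
    smul_eq_mul, mul_one]
  · intro t _ ht
    rw [hF, mul_conjTranspose_eq_zero h.1 ht.symm, smul_zero]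
  · simp

theorem normalForm_case4 (hQ : IsChannel Q) (hF : ∀ s t, block Q s t = F s * (F t)ᴴ)
    (h : Case.case4.Relations fun s => corner (F s)) : Case.case4.NormalForm Q := by
  have h1 {x y : Loop p} (hxy : x ≠ y) := conjTranspose_mul_eq_zero h.1 hxy
  have h2 (x y : Loop p) : (F x)ᴴ * F x = (F y)ᴴ * F y := by
    have := (h.2 x).trans (h.2 y).symm
    simp only [star_corner_mul] at this
    exact fromBlocks_right_injective this
  obtain ⟨U, hU, hP⟩ := exists_unitary_diag hQ hF fun x y hxy => h1 hxy
  have hUU : Uᴴ * U = 1 := Matrix.mem_unitaryGroup_iff'.mp hU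
  have hidem (x : Loop p) : block Q x x * block Q x x = block Q x x := by
    rw [hP]
    calc U * Matrix.single x x 1 * Uᴴ * (U * Matrix.single x x 1 * Uᴴ)
        = U * (Matrix.single x x 1 * (Uᴴ * U) * Matrix.single x x 1) * Uᴴ := by
          simp only [mul_assoc]
      _ = _ := by rw [hUU, mul_one, Matrix.single_mul_single_same, mul_one]
  -- For `q = q_{x,x} = F_x F_x†`, the product of `qF_x - F_x` with its adjoint is `q³ - 2q² + q`,
  -- which vanishes as `q` is idempotent. Together with the common value of `F_x† F_x` this gives
  -- the matrix unit relations.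
  have hfix (x : Loop p) : block Q x x * F x = F x := by
    rw [← sub_eq_zero, ← Matrix.self_mul_conjTranspose_eq_zero]
    have e1 : (block Q x x * F x - F x) * (block Q x x * F x - F x)ᴴ =
        block Q x x * block Q x x * block Q x x - block Q x x * block Q x x
          - block Q x x * block Q x x + block Q x x := by
      rw [Matrix.conjTranspose_sub, Matrix.conjTranspose_mul, block_conjTranspose hF]
      nth_rewrite 6 [hF]
      nth_rewrite 5 [hF]
      nth_rewrite 4 [hF]
      nth_rewrite 2 [hF]
      simp only [Matrix.sub_mul, Matrix.mul_sub, Matrix.mul_assoc]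
      rw [hF]
      abel
    rw [e1, hidem, hidem, sub_self, zero_sub, neg_add_cancel]
  obtain ⟨V, hV, hq⟩ := exists_unitary_of_matrixUnits (block Q) (block_conjTranspose hF) 0
    (fun h0 => by
      have := trace_block_self hQ 0
      rw [h0, Matrix.trace_zero] at this
      exact zero_ne_one this)
    (fun x y z w hyz => by
      rw [hF, hF, Matrix.mul_assoc, ← Matrix.mul_assoc _ (F z), h1 hyz, Matrix.zero_mul,
        Matrix.mul_zero])
    fun x y w => by
      rw [hF x y, hF y w, Matrix.mul_assoc, ← Matrix.mul_assoc _ (F y), h2 y x,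
        Matrix.mul_assoc (F x)ᴴ, ← Matrix.mul_assoc, ← hF, ← Matrix.mul_assoc, hfix, ← hF]
  refine ⟨V, hV, fun ρ => ?_⟩
  rw [applyChoi, id_eq]
  conv_rhs => rw [Matrix.matrix_eq_sum_single ρ]
  rw [Finset.mul_sum, Finset.sum_mul]
  refine Finset.sum_congr rfl fun s _ => ?_
  rw [Finset.mul_sum, Finset.sum_mul]
  refine Finset.sum_congr rfl fun t _ => ?_
  rw [hq, ← smul_mul_assoc, ← mul_smul_comm, Matrix.smul_single, smul_eq_mul, mul_one]

theorem block_twist {c : ZMod p} (hF : ∀ s t, block Q s t = F s * (F t)ᴴ)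
    (h : WeylRelations c fun s => corner (F s)) (a b : Loop p) :
    block Q a (-b) = phase (c * cross a b) • block Q 0 (-(a + b)) := by
  have := h.twist a b
  simp only [corner_mul_star, Matrix.fromBlocks_smul, smul_zero, ← hF] at this
  exact fromBlocks_left_injective this

theorem block_weyl {c : ZMod p} (hF : ∀ s t, block Q s t = F s * (F t)ᴴ)
    (h : WeylRelations c fun s => corner (F s)) (u v : Loop p) :
    block Q 0 (-u) * block Q 0 (-v) =
      phase (c * cross u v) • (block Q 0 0 * block Q 0 (-(u + v))) := by
  have := h.weyl u v
  simp only [corner_mul_star, Matrix.fromBlocks_multiply, Matrix.fromBlocks_smul, smul_zero,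
    Matrix.mul_zero, Matrix.zero_mul, add_zero, ← hF, neg_zero] at this
  exact fromBlocks_left_injective this

theorem block_eq {c : ZMod p} (hF : ∀ s t, block Q s t = F s * (F t)ᴴ)
    (h : WeylRelations c fun s => corner (F s)) (s t : Loop p) :
    block Q s t = phase (-(c * cross s t)) • block Q 0 (-(s - t)) := by
  have := block_twist hF h s (-t)
  rwa [neg_neg, cross_neg_right, mul_neg, ← sub_eq_add_neg] at this

theorem block_zero_conjTranspose {c : ZMod p} (hF : ∀ s t, block Q s t = F s * (F t)ᴴ)
    (h : WeylRelations c fun s => corner (F s)) (u : Loop p) :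
    (block Q 0 (-u))ᴴ = block Q 0 (- -u) := by
  rw [block_conjTranspose hF, block_eq hF h, cross_zero_right, mul_zero, neg_zero, phase_zero,
    one_smul, sub_zero]

theorem normalForm_case3a (hQ : IsChannel Q) (hF : ∀ s t, block Q s t = F s * (F t)ᴴ)
    (h : WeylRelations (0 : ZMod p) fun s => corner (F s)) : Case.case3a.NormalForm Q := by
  obtain ⟨U, hU, hV⟩ := exists_unitary_of_weyl (fun u => block Q 0 (-u))
    (block_zero_conjTranspose hF h) (fun u v => by
      simpa [phase_zero] using block_weyl hF h u v) fun u => by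
      rw [hQ.2, delta]
      exact if_congr (by rw [eq_comm, neg_eq_zero]) rfl rfl
  refine ⟨U, hU, fun ρ => ?_⟩
  rw [dephaseX_eq, dephaseXZ_eq_sum, applyChoi, mul_smul_comm, smul_mul_assoc, Finset.mul_sum,
    Finset.sum_mul, Finset.smul_sum]
  refine Finset.sum_congr rfl fun s _ => ?_
  rw [Finset.mul_sum, Finset.sum_mul, Finset.smul_sum]
  refine Finset.sum_congr rfl fun t _ => ?_
  rw [block_eq hF h, hV]
  simp only [mul_smul_comm, smul_mul_assoc, zero_mul, neg_zero, phase_zero, one_smul]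
  rw [smul_comm]

end NormalForms

end Blocks

/-! ### Recovery in Case 3b -/

section Recovery

/-- A pseudo-inverse of the square root of a positive semidefinite matrix. -/
theorem exists_sqrt_pinv {ι : Type*} [Fintype ι] [DecidableEq ι] {ρ : Matrix ι ι ℂ}
    (hρ : ρ.PosSemidef) :
    ∃ C : Matrix ι ι ℂ, Cᴴ = C ∧ (∀ M, Commute ρ M → Commute C M) ∧ C * C * ρ * ρ = ρ := by
  have hsa : IsSelfAdjoint ρ := hρ.isHermitian
  have hcont (f : ℝ → ℝ) : ContinuousOn f (spectrum ℝ ρ) := by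
    have : (spectrum ℝ ρ).Finite := Matrix.finite_real_spectrum
    exact this.continuousOn f
  -- The convention `0⁻¹ = 0` makes `f` vanish on the kernel, so `f(x)² x² = x` also holds at 0.
  let f : ℝ → ℝ := fun x => (√x)⁻¹
  refine ⟨cfc f ρ, cfc_predicate f ρ, fun M hM => Commute.cfc_real hM f, ?_⟩
  conv_lhs => rw [← cfc_id' ℝ ρ]
  conv_rhs => rw [← cfc_id' ℝ ρ]
  simp only [cfc_id' ℝ ρ]
  have h1 : cfc (fun x => f x * f x * x * x) ρ = cfc f ρ * cfc f ρ * ρ * ρ := by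
    rw [cfc_mul _ _ ρ (hcont _) (hcont _), cfc_mul _ _ ρ (hcont _) (hcont _),
      cfc_mul _ _ ρ (hcont _) (hcont _), cfc_id' ℝ ρ]
  rw [← h1]
  conv_rhs => rw [← cfc_id' ℝ ρ]
  refine cfc_congr fun x hx => ?_
  have hx0 : 0 ≤ x := by
    rw [hρ.isHermitian.spectrum_real_eq_range_eigenvalues] at hx
    obtain ⟨i, rfl⟩ := hx
    exact hρ.eigenvalues_nonneg i
  simp only [f]
  rcases hx0.eq_or_lt with rfl | hx1
  · simp
  · have h2 := Real.mul_self_sqrt hx0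
    rw [← mul_inv, h2]
    field_simp

variable {p : ℕ} [Fact p.Prime]

/-- `applyChoi` as a linear map. -/
noncomputable def applyChoiLin {p : ℕ} [NeZero p] (Q : ChoiMatrix p) :
    LogicalOp p →ₗ[ℂ] LogicalOp p where
  toFun := applyChoi Q
  map_add' ρ σ := by simp [applyChoi, add_smul, Finset.sum_add_distrib]
  map_smul' c ρ := by simp [applyChoi, Finset.smul_sum, smul_smul]

theorem applyChoiLin_apply (Q : ChoiMatrix p) (ρ : LogicalOp p) :
    applyChoiLin Q ρ = applyChoi Q ρ := rfl

variable {Q : ChoiMatrix p} {F : Loop p → Matrix (Loop p) (Loop p × Loop p) ℂ} {c : ZMod p}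

/-- The form of the blocks makes `Q` invariant under precomposition with each operator that `N_c`
averages over. Hence `Q ∘ N_c = Q`, and `Q` itself can play the part of `S`. -/
theorem applyChoi_dephaseXZ (hq : ∀ s t, block Q s t =
      phase (-(c * cross s t)) • block Q 0 (-(s - t))) (σ : LogicalOp p) :
    applyChoi Q (dephaseXZ c σ) = applyChoi Q σ := by
  have hshift (r s t : Loop p) :
      phase (-(c * cross r (s - t))) • block Q (s + r) (t + r) = block Q s t := by
    rw [hq, hq s t, smul_smul, ← phase_add, add_sub_add_right_eq_sub]
    congr 2
    simp [cross]
    ring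
  have h1 : applyChoi Q (dephaseXZ c σ) = ((p : ℂ) ^ 2)⁻¹ • ∑ r : Loop p, ∑ s : Loop p,
      ∑ t : Loop p, (phase (-(c * cross r (s - t))) * σ (s - r) (t - r)) • block Q s t := by
    simp only [applyChoi, dephaseXZ_apply, ← smul_smul, Finset.mul_sum, Finset.sum_smul,
      Finset.smul_sum]
    rw [Finset.sum_comm]
    conv_rhs => rw [Finset.sum_comm]; enter [2, s]; rw [Finset.sum_comm]
    rw [Finset.sum_comm]
  rw [h1]
  have h2 (r : Loop p) : ∑ s : Loop p, ∑ t : Loop p,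
      (phase (-(c * cross r (s - t))) * σ (s - r) (t - r)) • block Q s t = applyChoi Q σ := by
    rw [← Equiv.sum_comp (Equiv.addRight r), applyChoi]
    refine Finset.sum_congr rfl fun s _ => ?_
    rw [← Equiv.sum_comp (Equiv.addRight r)]
    refine Finset.sum_congr rfl fun t _ => ?_
    simp only [Equiv.coe_addRight, add_sub_add_right_eq_sub, add_sub_cancel_right]
    rw [mul_comm, mul_smul, hshift]
  simp only [h2, Finset.sum_const, Finset.card_univ, Fintype.card_prod, ZMod.card]
  rw [← Nat.cast_smul_eq_nsmul ℂ, smul_smul]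
  have := natCast_sq_ne_zero (p := p)
  push_cast
  rw [← sq, inv_mul_cancel₀ this, one_smul]

/-- The Choi matrix of the recovery map
`Y ↦ p⁻² (Q†[C Y C] + tr (N Y))`. -/
noncomputable def recovery (F : Loop p → Matrix (Loop p) (Loop p × Loop p) ℂ)
    (C N : LogicalOp p) : ChoiMatrix p :=
  ((p : ℂ) ^ 2)⁻¹ •
    ((Matrix.of fun a k => star ((C * F a.1) a.2 k) :
        Matrix (Loop p × Loop p) (Loop p × Loop p) ℂ) *
      (Matrix.of fun a k => star ((C * F a.1) a.2 k) :
        Matrix (Loop p × Loop p) (Loop p × Loop p) ℂ)ᴴ +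
    Matrix.kronecker (1 : LogicalOp p) Nᵀ)

theorem recovery_apply (hF : ∀ s t, block Q s t = F s * (F t)ᴴ) {C N : LogicalOp p} (hC : Cᴴ = C)
    (s i t j : Loop p) : recovery F C N (s, i) (t, j) =
      ((p : ℂ) ^ 2)⁻¹ * (star ((C * block Q s t * C) i j) + if s = t then N j i else 0) := by
  rw [recovery, Matrix.smul_apply, Matrix.add_apply, smul_eq_mul]
  congr 2
  · have : C * block Q s t * C = C * F s * (C * F t)ᴴ := by
      rw [Matrix.conjTranspose_mul, hC, hF]
      simp only [Matrix.mul_assoc]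
    rw [this, Matrix.mul_apply, Matrix.mul_apply, star_sum]
    refine Finset.sum_congr rfl fun k _ => ?_
    simp
  · simp [Matrix.kronecker, Matrix.one_apply]

theorem applyChoi_recovery_apply (hF : ∀ s t, block Q s t = F s * (F t)ᴴ) {C N : LogicalOp p}
    (hC : Cᴴ = C) (Y : LogicalOp p) (s t : Loop p) : applyChoi (recovery F C N) Y s t =
      ((p : ℂ) ^ 2)⁻¹ * (((C * block Q s t * C)ᴴ * Y).trace +
        if s = t then (N * Y).trace else 0) := by
  have h1 (M : LogicalOp p) : (M * Y).trace = ∑ i, ∑ j, Y i j * M j i := by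
    rw [Matrix.trace_mul_comm]
    simp [Matrix.trace, Matrix.mul_apply]
  rw [applyChoi, Matrix.sum_apply, h1, h1]
  simp only [Matrix.sum_apply, Matrix.smul_apply, block, Matrix.of_apply, recovery_apply hF hC,
    smul_eq_mul]
  rw [mul_add, Finset.mul_sum]
  simp only [mul_add, Finset.sum_add_distrib, Finset.mul_sum]
  congr 1
  · refine Finset.sum_congr rfl fun i _ => Finset.sum_congr rfl fun j _ => ?_
    rw [Matrix.conjTranspose_apply, mul_left_comm]
  · split_ifs
    · simp only [Finset.mul_sum]
      exact Finset.sum_congr rfl fun i _ => Finset.sum_congr rfl fun j _ => mul_left_comm _ _ _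
    · simp

/-- The recovery is of Petz type: `C` is the inverse square root of `ρ = q_{0,0}` on its support, `E
= CρC` is the support projection, and the term with `1 - E` restores trace preservation. The Weyl
relations imply that `C` cancels the unknown `ρ` in `R ∘ Q`. -/
theorem isOptimallyRecovered (hQ : IsChannel Q) (hF : ∀ s t, block Q s t = F s * (F t)ᴴ)
    (h : WeylRelations c fun s => corner (F s)) : IsOptimallyRecovered Q (dephaseXZ c) := by
  have hp := natCast_sq_ne_zero (p := p)
  set V : Loop p → LogicalOp p := fun u => block Q 0 (-u) with hVdef
  set ρ := block Q 0 0 with hρdef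
  have hV0 : V 0 = ρ := by simp [hVdef, hρdef]
  have hVV (u v : Loop p) : V u * V v = phase (c * cross u v) • (ρ * V (u + v)) :=
    block_weyl hF h u v
  have hVH (u : Loop p) : (V u)ᴴ = V (-u) := block_zero_conjTranspose hF h u
  have hVt (u : Loop p) : (V u).trace = if u = 0 then 1 else 0 := by
    rw [hVdef, hQ.2]
    exact if_congr (by rw [eq_comm, neg_eq_zero]) rfl rfl
  have hq (s t : Loop p) : block Q s t = phase (-(c * cross s t)) • V (s - t) := block_eq hF h s t
  have hρ : ρ.PosSemidef := by
    rw [hρdef, hF]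
    exact Matrix.posSemidef_self_mul_conjTranspose _
  have hρH : ρᴴ = ρ := hρ.isHermitian
  have hVρ (u : Loop p) : Commute ρ (V u) := by
    have := hVV u 0
    rw [cross_zero_right, mul_zero, phase_zero, one_smul, add_zero, hV0] at this
    exact this.symm
  obtain ⟨C, hC, hcomm, hCρ⟩ := exists_sqrt_pinv hρ
  have hCV (u : Loop p) : Commute C (V u) := hcomm _ (hVρ u)
  have hCρc : Commute C ρ := hcomm _ (Commute.refl ρ)
  set E := C * C * ρ with hE
  have hEH : Eᴴ = E := by
    rw [hE, Matrix.conjTranspose_mul, Matrix.conjTranspose_mul, hC, hρH]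
    exact ((hCρc.mul_left hCρc).eq).symm
  have hEρ : E * ρ = ρ := hCρ
  have hEE : E * E = E := by
    calc E * E = C * C * (ρ * (C * C)) * ρ := by rw [hE]; simp only [mul_assoc]
      _ = C * C * (E * ρ) := by rw [← (hCρc.mul_left hCρc).eq, ← hE, mul_assoc]
      _ = E := by rw [hEρ]
  -- Since `V u (V u)† = ρ²`, the range of `V u` lies in the support of `ρ`.
  have hEV (u : Loop p) : E * V u = V u := by
    rw [← sub_eq_zero, ← Matrix.self_mul_conjTranspose_eq_zero]
    have h1 : V u * V (-u) = ρ * ρ := by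
      rw [hVV, cross_neg_right, cross_self, neg_zero, mul_zero, phase_zero, one_smul,
        add_neg_cancel, hV0]
    have h2 : E * V u - V u = (E - 1) * V u := by rw [sub_mul, one_mul]
    rw [h2, Matrix.conjTranspose_mul, hVH, mul_assoc, ← mul_assoc (V u), h1, ← mul_assoc,
      ← mul_assoc, sub_mul, hEρ, one_mul, sub_self, zero_mul, zero_mul]
  have hCC : C * ρ * C = E := by rw [mul_assoc, ← hCρc.eq, ← mul_assoc]
  have hss (s : Loop p) : block Q s s = ρ := by
    rw [hq, cross_self, mul_zero, neg_zero, phase_zero, one_smul, sub_self, hV0]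
  refine ⟨recovery F C (1 - E), Q, ⟨?_, fun i j => ?_⟩, hQ, fun σ => ?_, fun σ =>
    applyChoi_dephaseXZ hq σ⟩
  · refine Matrix.PosSemidef.smul (Matrix.PosSemidef.add
      (Matrix.posSemidef_self_mul_conjTranspose _) (Matrix.PosSemidef.kronecker .one ?_)) ?_
    · refine Matrix.PosSemidef.transpose (M := 1 - E) ?_
      have : 1 - E = (1 - E)ᴴ * (1 - E) := by
        rw [Matrix.conjTranspose_sub, hEH, Matrix.conjTranspose_one, sub_mul, mul_sub, mul_sub, hEE]
        simp
      rw [this]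
      exact Matrix.posSemidef_conjTranspose_mul_self _
    · have : ((p : ℂ) ^ 2)⁻¹ = (((p : ℝ) ^ 2)⁻¹ : ℝ) := by push_cast; rfl
      rw [this]
      exact Complex.zero_le_real.mpr (by positivity)
  -- Each of the `p²` outputs contributes `p⁻² (E + (1 - E))`, because all diagonal blocks of `Q`
  -- equal `ρ` and `CρC = E`.
  · have h1 : (block (recovery F C (1 - E)) i j).trace =
        ∑ _s : Loop p, ((p : ℂ) ^ 2)⁻¹ * (star (E i j) + (1 - E) j i) := by
      rw [Matrix.trace]
      refine Finset.sum_congr rfl fun s _ => ?_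
      rw [Matrix.diag_apply, block, Matrix.of_apply, recovery_apply hF hC, hss, hCC, if_pos rfl]
    have h2 : star (E i j) = E j i := by
      conv_rhs => rw [← hEH]
      rfl
    rw [h1, h2, Matrix.sub_apply, add_sub_cancel, Matrix.one_apply]
    simp only [Finset.sum_const, Finset.card_univ, Fintype.card_prod, ZMod.card, nsmul_eq_mul]
    push_cast
    rw [← sq, ← mul_assoc, mul_inv_cancel₀ hp, one_mul]
    exact if_congr eq_comm rfl rfl
  · have key (s t : Loop p) : applyChoi (recovery F C (1 - E)) (block Q s t) =
        ((p : ℂ) ^ 2)⁻¹ • phase (-(c * cross s t)) • weyl c (s - t) := by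
      ext i j
      rw [applyChoi_recovery_apply hF hC]
      have h1 : ((1 - E) * block Q s t).trace = 0 := by
        rw [hq, mul_smul_comm, sub_mul, hEV, one_mul, sub_self, smul_zero, Matrix.trace_zero]
      -- Up to phases the product is `C² V(j-i) V(s-t) = C² ρ V(j-i+s-t) = V(j-i+s-t)`, and the
      -- trace of `V` is a delta function.
      have h2 : ((C * block Q i j * C)ᴴ * block Q s t).trace =
          phase (c * cross i j - c * cross s t + c * cross (j - i) (s - t)) *
            if i = s - t + j then 1 else 0 := by
        have e1 : (C * block Q i j * C)ᴴ = phase (c * cross i j) • (C * C * V (j - i)) := by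
          rw [hq, Matrix.conjTranspose_mul, Matrix.conjTranspose_mul, hC,
            Matrix.conjTranspose_smul, star_phase, neg_neg, hVH, neg_sub, smul_mul_assoc,
            mul_smul_comm, ← (hCV _).eq, mul_assoc]
        rw [e1, hq s t, smul_mul_smul_comm, mul_assoc, hVV, mul_smul_comm, ← mul_assoc, ← hE, hEV,
          smul_smul, Matrix.trace_smul, smul_eq_mul, hVt, ← phase_add, ← phase_add,
          ← sub_eq_add_neg]
        congr 1
        refine if_congr ⟨fun h' => ?_, fun h' => ?_⟩ rfl rfl
        · rw [← sub_eq_zero, ← neg_eq_zero, ← h']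
          abel
        · rw [h']
          abel
      rw [h1, h2, ite_self, add_zero, Matrix.smul_apply, Matrix.smul_apply, weyl, Matrix.of_apply,
        smul_eq_mul, smul_eq_mul]
      congr 1
      split_ifs with h'
      · rw [mul_one, ← phase_add, h']
        congr 1
        simp [cross]
        ring
      · simp
    rw [dephaseXZ_eq_sum]
    conv_lhs => rw [applyChoi.eq_1 Q, ← applyChoiLin_apply]
    simp only [map_sum, map_smul, applyChoiLin_apply, key, Finset.smul_sum]
    refine Finset.sum_congr rfl fun s _ => Finset.sum_congr rfl fun t _ => ?_
    rw [smul_comm]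

end Recovery

/-! ### The tensors of the normal forms -/

section Converse

variable {p n : ℕ}

theorem block_eq_applyChoi [NeZero p] (Q : ChoiMatrix p) (s t : Loop p) :
    block Q s t = applyChoi Q (Matrix.single s t 1) := by
  rw [applyChoi, Finset.sum_eq_single s, Finset.sum_eq_single t]
  · simp
  · intro b _ hb
    rw [Matrix.single_apply, if_neg fun h => hb h.2.symm, zero_smul]
  · simp
  · intro b _ hb
    refine Finset.sum_eq_zero fun x _ => ?_
    rw [Matrix.single_apply, if_neg fun h => hb h.1.symm, zero_smul]
  · simp

theorem expectation_eq_of_replicaTrace [NeZero p] {Θ : Type*} [Fintype Θ]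
    (E : LogicalEnsemble p Θ) {f : LoopTensor p n} (hn : n ≠ 0)
    (h : ∀ θ t, replicaTrace (E.choi θ) t = f t * ((block (E.choi θ) 0 0) ^ n).trace) :
    E.expectation n = f := by
  obtain ⟨k, rfl⟩ := Nat.exists_eq_succ_of_ne_zero hn
  funext t
  rw [LogicalEnsemble.expectation, div_eq_iff (denominator_ne_zero E k), Finset.mul_sum]
  refine Finset.sum_congr rfl fun θ _ => ?_
  rw [h, mul_left_comm]

theorem prod_ofFn_ite {M : Type*} [MonoidWithZero M] (P : Fin n → Prop) [DecidablePred P]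
    (a : Fin n → M) [Decidable (∀ i, P i)] :
    (List.ofFn fun i => if P i then a i else 0).prod =
      if ∀ i, P i then (List.ofFn a).prod else 0 := by
  split_ifs with h
  · simp [h]
  · obtain ⟨i, hi⟩ := not_forall.mp h
    exact List.prod_eq_zero ((List.mem_ofFn' _ _).mpr ⟨i, if_neg hi⟩)

theorem replicaTrace_of_diagonal [NeZero p] {Q : ChoiMatrix p} {B : Loop p → Loop p → LogicalOp p}
    (h : ∀ s t, block Q s t = if s = t then B s t else 0) (t : Fin (2 * n) → Loop p) :
    replicaTrace Q t = Case.case1.tensor n t *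
      (List.ofFn fun i : Fin n => B (t (ket i)) (-t (bra i))).prod.trace := by
  classical
  simp only [replicaTrace, h, prod_ofFn_ite, Case.tensor, prod_delta, eq_neg_iff_add_eq_zero]
  split_ifs <;> simp

theorem isFaithfulTrace_trace {J : Type*} [Fintype J] [DecidableEq J] :
    IsFaithfulTrace (Matrix.traceLinearMap J ℂ ℂ) where
  comm a b := Matrix.trace_mul_comm a b
  map_star a := Matrix.trace_conjTranspose a
  faithful _ h := Matrix.trace_conjTranspose_mul_self_eq_zero_iff.mp h

theorem case4_tensor_zero [NeZero p] : Case.case4.tensor n (0 : Fin (2 * n) → Loop p) = 1 := by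
  simp [Case.tensor, delta]

/-- The operators `U|s⟩⟨0|` satisfy the relations of Case 4, and their products `A_s A_t*` are the
conjugated matrix units, so the word formula applies. -/
theorem trace_prod_matrixUnits [NeZero p] {U : LogicalOp p}
    (hU : U ∈ Matrix.unitaryGroup (Loop p) ℂ) (t : Fin (2 * n) → Loop p) :
    (List.ofFn fun i : Fin n =>
        U * Matrix.single (t (ket i)) (-t (bra i)) 1 * Uᴴ).prod.trace =
      Case.case4.tensor n t * ((U * Matrix.single 0 0 1 * Uᴴ) ^ n).trace := by
  have hUU : Uᴴ * U = 1 := (Matrix.mem_unitaryGroup_iff').mp hU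
  let A : Loop p → LogicalOp p := fun s => U * Matrix.single s 0 1
  have hA1 (s t : Loop p) : A s * star (A t) = U * Matrix.single s t 1 * Uᴴ := by
    simp only [A, Matrix.star_eq_conjTranspose, Matrix.conjTranspose_mul,
      Matrix.conjTranspose_single, star_one]
    rw [mul_assoc, ← mul_assoc (Matrix.single s 0 1), Matrix.single_mul_single_same, mul_one,
      mul_assoc]
  have hA2 (s t : Loop p) : star (A s) * A t = if s = t then Matrix.single 0 0 1 else 0 := by
    simp only [A, Matrix.star_eq_conjTranspose, Matrix.conjTranspose_mul,
      Matrix.conjTranspose_single, star_one]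
    rw [mul_assoc, ← mul_assoc Uᴴ, hUU, one_mul]
    split_ifs with h
    · rw [h, Matrix.single_mul_single_same, mul_one]
    · rw [Matrix.single_mul_single_of_ne (h := h)]
  have h4 : Case.case4.Relations A :=
    ⟨fun x y h => by rw [hA2, if_neg h], fun x => by rw [hA2, hA2, if_pos rfl, if_pos rfl]⟩
  have key (t : Fin (2 * n) → Loop p) : replica (Matrix.traceLinearMap (Loop p) ℂ ℂ) A n t =
      Matrix.traceLinearMap (Loop p) ℂ ℂ ((dual A 0 * star (dual A 0)) ^ n) *
        Case.case4.tensor n t := by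
    rw [← isFaithfulTrace_trace.replica_dual,
      replica_of_case1_relations (dual_relations_case1.mpr h4), case1_tensor_rotate]
  have h0 := key 0
  have ht := key t
  rw [case4_tensor_zero, mul_one] at h0
  rw [← h0, replica, replica] at ht
  simp only [hA1, Pi.zero_apply, neg_zero, List.ofFn_const, List.prod_replicate] at ht
  rw [mul_comm]
  exact ht

/-- The blocks are phases times conjugated Weyl operators scaled by `p⁻²`; the product formula
collects the phases, and the trace of the last Weyl operator gives the delta function. -/
theorem weyl_replicaTrace [Fact p.Prime] {Q : ChoiMatrix p} {c : ZMod p}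
    (hQ : EqUpToUnitary Q (dephaseXZ c)) (hn : n ≠ 0) (t : Fin (2 * n) → Loop p) :
    replicaTrace Q t = (case3 c).tensor n t * ((block Q 0 0) ^ n).trace := by
  obtain ⟨k, rfl⟩ := Nat.exists_eq_succ_of_ne_zero hn
  obtain ⟨U, hU, hQ⟩ := hQ
  have hUU : Uᴴ * U = 1 := (Matrix.mem_unitaryGroup_iff').mp hU
  let V : Loop p → LogicalOp p := fun u => ((p : ℂ) ^ 2)⁻¹ • (U * weyl c u * Uᴴ)
  have hV (u v : Loop p) : V u * V v = phase (c * cross u v) • (V 0 * V (u + v)) := by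
    simp only [V, smul_mul_smul_comm, mul_assoc]
    simp only [← mul_assoc Uᴴ, hUU, one_mul]
    simp only [← mul_assoc (weyl c _) (weyl c _), weyl_mul, weyl_zero, one_mul, mul_smul_comm,
      smul_mul_assoc]
    rw [smul_comm]
  have hq (s t : Loop p) : block Q s (-t) = phase (c * cross s t) • V (s + t) := by
    have h1 : dephaseXZ c (Matrix.single s (-t) 1) =
        ((p : ℂ) ^ 2)⁻¹ • phase (c * cross s t) • weyl c (s + t) := by
      rw [dephaseXZ_eq_sum, Finset.sum_eq_single s, Finset.sum_eq_single (-t)]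
      · rw [Matrix.single_apply_same, one_smul, cross_neg_right, mul_neg, neg_neg, sub_neg_eq_add]
      · intro b _ hb
        rw [Matrix.single_apply, if_neg fun h => hb h.2.symm, zero_smul]
      · simp
      · intro b _ hb
        refine Finset.sum_eq_zero fun x _ => ?_
        rw [Matrix.single_apply, if_neg fun h => hb h.1.symm, zero_smul]
      · simp
    rw [block_eq_applyChoi, hQ, h1]
    simp only [V, mul_smul_comm, smul_mul_assoc]
    rw [smul_comm]
  have hq0 : block Q 0 0 = V 0 := by
    have := hq 0 0
    rwa [neg_zero, cross_zero_left, mul_zero, phase_zero, one_smul, add_zero] at this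
  have hVtrace (j : ℕ) (u : Loop p) : (V 0 ^ j * V u).trace =
      ((p : ℂ) ^ 2)⁻¹ ^ j * delta u := by
    have hV1 : V 0 ^ j * V u = ((p : ℂ) ^ 2)⁻¹ ^ j • V u := by
      induction j with
      | zero => simp
      | succ j ih =>
        rw [pow_succ', mul_assoc, ih, mul_smul_comm, pow_succ _ j, mul_smul]
        congr 1
        simp only [V, smul_mul_smul_comm, mul_assoc, weyl_zero, one_mul]
        rw [← mul_assoc Uᴴ, hUU, one_mul, mul_smul]
    rw [hV1, Matrix.trace_smul, Matrix.trace_smul, Matrix.trace_mul_comm, ← mul_assoc, hUU, one_mul,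
      trace_weyl, smul_eq_mul, smul_eq_mul, inv_mul_cancel_left₀ natCast_sq_ne_zero]
  rw [replicaTrace]
  simp only [hq]
  rw [prod_weyl c V hV, hq0, pow_succ, Matrix.trace_smul, hVtrace, hVtrace, case3_tensor, delta,
    delta, if_pos rfl, smul_eq_mul]
  ring

theorem expectation_of_normalForm [Fact p.Prime] {Θ : Type*} [Fintype Θ]
    (E : LogicalEnsemble p Θ) (hn : n ≠ 0) (κ : Case p) (h : ∀ θ, κ.NormalForm (E.choi θ)) :
    E.expectation n = κ.tensor n := by
  refine expectation_eq_of_replicaTrace E hn fun θ t => ?_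
  have hQ := h θ
  cases κ with
  | case1 =>
    rw [replicaTrace_of_diagonal (B := fun _ _ => block (E.choi θ) 0 0), List.ofFn_const,
      List.prod_replicate]
    intro s t
    rw [block_eq_applyChoi, hQ]
    split_ifs with hst
    · rw [hst, Matrix.trace_single_eq_same, one_smul]
    · rw [Matrix.trace_single_eq_of_ne _ _ _ hst, zero_smul]
  | case2 =>
    obtain ⟨U, hU, hQ⟩ := hQ
    have hq (s t : Loop p) :
        block (E.choi θ) s t = if s = t then U * Matrix.single s t 1 * Uᴴ else 0 := by
      rw [block_eq_applyChoi, hQ, dephaseZ_eq]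
      split_ifs with hst
      · rw [← hst, ← Matrix.diagonal_single]
        congr 3
        funext i
        simp [Pi.single_apply, eq_comm]
      · have : (fun i => Matrix.single s t (1 : ℂ) i i) = 0 := by
          funext i
          rw [Matrix.single_apply, if_neg fun h => hst (h.1.trans h.2.symm), Pi.zero_apply]
        rw [this, Pi.zero_def, Matrix.diagonal_zero, mul_zero, zero_mul]
    rw [replicaTrace_of_diagonal hq, trace_prod_matrixUnits hU, case2_tensor, hq, if_pos rfl]
    exact (mul_assoc _ _ _).symm
  | case3a =>
    rw [← case3_zero]
    obtain ⟨U, hU, hQ⟩ := hQ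
    exact weyl_replicaTrace ⟨U, hU, fun ρ => by rw [hQ, dephaseX_eq]⟩ hn t
  | case3b c =>
    rw [← case3_coe]
    exact weyl_replicaTrace hQ hn t
  | case4 =>
    obtain ⟨U, hU, hQ⟩ := hQ
    simp only [replicaTrace, block_eq_applyChoi, hQ, id]
    exact trace_prod_matrixUnits hU t

end Converse

/-! ### Channels of each normal form -/

section Existence

variable {p : ℕ} [Fact p.Prime]

theorem isChannel_smul_one : IsChannel (((p : ℂ) ^ 2)⁻¹ • 1 : ChoiMatrix p) ∧
    Case.case1.NormalForm (((p : ℂ) ^ 2)⁻¹ • 1 : ChoiMatrix p) := by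
  have hb (s t : Loop p) : block (((p : ℂ) ^ 2)⁻¹ • 1 : ChoiMatrix p) s t =
      if s = t then ((p : ℂ) ^ 2)⁻¹ • 1 else 0 := by
    ext i j
    by_cases h : s = t <;> simp [block, Matrix.one_apply, h]
  refine ⟨⟨Matrix.PosSemidef.one.smul (inv_nonneg.mpr (by positivity)), fun s t => ?_⟩, fun ρ => ?_⟩
  · rw [hb]
    split_ifs
    · rw [Matrix.trace_smul, Matrix.trace_one, Fintype.card_prod, ZMod.card, ← sq, Nat.cast_pow,
        smul_eq_mul, inv_mul_cancel₀ natCast_sq_ne_zero]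
    · exact Matrix.trace_zero _ _
  · simp [applyChoi, hb, Matrix.trace, Finset.sum_smul]

/-- The Choi matrix is `p⁻² K K†`, where the columns of `K` are the vectorized unitaries. A constant
family gives the unitary case, the loop operators give the dephasing channels. -/
theorem exists_channel_of_unitaries (W : Loop p → LogicalOp p) (hW : ∀ k, (W k)ᴴ * W k = 1) :
    ∃ Q : ChoiMatrix p, IsChannel Q ∧
      ∀ ρ, applyChoi Q ρ = ((p : ℂ) ^ 2)⁻¹ • ∑ k, W k * ρ * (W k)ᴴ := by
  let K : Matrix (Loop p × Loop p) (Loop p) ℂ := Matrix.of fun a k => W k a.1 a.2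
  have hb (s t i j : Loop p) : block (((p : ℂ) ^ 2)⁻¹ • (K * Kᴴ)) s t i j =
      ((p : ℂ) ^ 2)⁻¹ * ∑ k, W k i s * star (W k j t) := by
    simp [block, K, Matrix.mul_apply]
  refine ⟨((p : ℂ) ^ 2)⁻¹ • (K * Kᴴ), ⟨(Matrix.posSemidef_self_mul_conjTranspose K).smul
    (inv_nonneg.mpr (by positivity)), fun s t => ?_⟩, fun ρ => ?_⟩
  · have (k : Loop p) : ∑ i, W k i s * star (W k i t) = if s = t then 1 else 0 := by
      have := congrFun (congrFun (hW k) t) s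
      rw [Matrix.mul_apply, Matrix.one_apply] at this
      rw [if_congr eq_comm rfl rfl, ← this]
      exact Finset.sum_congr rfl fun i _ => mul_comm _ _
    simp only [Matrix.trace, Matrix.diag_apply, hb]
    rw [← Finset.mul_sum, Finset.sum_comm]
    simp only [this, Finset.sum_const, Finset.card_univ, Fintype.card_prod, ZMod.card, ← sq,
      nsmul_eq_mul, Nat.cast_pow]
    rw [inv_mul_cancel_left₀ natCast_sq_ne_zero]
  · ext i j
    simp only [applyChoi, Matrix.sum_apply, Matrix.smul_apply, smul_eq_mul, hb, Matrix.mul_apply,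
      Matrix.conjTranspose_apply, Finset.mul_sum, Finset.sum_mul]
    rw [Finset.sum_comm]
    conv_lhs => enter [2, t]; rw [Finset.sum_comm]
    rw [Finset.sum_comm]
    refine Finset.sum_congr rfl fun k _ => Finset.sum_congr rfl fun t _ =>
      Finset.sum_congr rfl fun s _ => ?_
    ring

theorem conjTranspose_loopX (s : Loop p) : (loopX s)ᴴ = loopX (-s) := by
  ext i j
  rw [Matrix.conjTranspose_apply, loopX, loopX, Matrix.of_apply, Matrix.of_apply, apply_ite star,
    star_one, star_zero]
  refine if_congr ⟨fun h => ?_, fun h => ?_⟩ rfl rfl <;> rw [h] <;> abel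

theorem conjTranspose_loopZ (s : Loop p) : (loopZ s)ᴴ = loopZ (-s) := by
  rw [loopZ, loopZ, Matrix.diagonal_conjTranspose]
  congr 1
  funext t
  rw [Pi.star_apply, star_phase, cross_neg_left]

theorem loopX_neg_mul (s : Loop p) : loopX (-s) * loopX s = 1 := by
  ext i j
  rw [loopX_mul_apply, loopX, Matrix.of_apply, Matrix.one_apply, sub_neg_eq_add, add_comm i]
  exact if_congr (add_right_inj s) rfl rfl

theorem loopZ_neg_mul (s : Loop p) : loopZ (-s) * loopZ s = 1 := by
  rw [loopZ, loopZ, Matrix.diagonal_mul_diagonal, ← Matrix.diagonal_one]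
  congr 1
  funext t
  rw [← phase_add, cross_neg_left, neg_add_cancel, phase_zero]

theorem eqUpToUnitary_of_eq {Q : ChoiMatrix p} {N : LogicalOp p → LogicalOp p}
    (h : ∀ ρ, applyChoi Q ρ = N ρ) : EqUpToUnitary Q N :=
  ⟨1, one_mem _, fun ρ => by rw [h, one_mul, Matrix.conjTranspose_one, mul_one]⟩

theorem exists_channel_normalForm (κ : Case p) :
    ∃ Q : ChoiMatrix p, IsChannel Q ∧ κ.NormalForm Q := by
  cases κ with
  | case1 => exact ⟨_, isChannel_smul_one⟩
  | case2 =>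
    obtain ⟨Q, hQ, h⟩ := exists_channel_of_unitaries (p := p) loopZ fun k => by
      rw [conjTranspose_loopZ, loopZ_neg_mul]
    simp only [conjTranspose_loopZ] at h
    exact ⟨Q, hQ, eqUpToUnitary_of_eq h⟩
  | case3a =>
    obtain ⟨Q, hQ, h⟩ := exists_channel_of_unitaries (p := p) loopX fun k => by
      rw [conjTranspose_loopX, loopX_neg_mul]
    simp only [conjTranspose_loopX] at h
    exact ⟨Q, hQ, eqUpToUnitary_of_eq h⟩
  | case3b c =>
    obtain ⟨Q, hQ, h⟩ := exists_channel_of_unitaries (p := p)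
      (fun s => loopX s * loopZ (-((c : ZMod p) • s))) fun k => by
        rw [Matrix.conjTranspose_mul, conjTranspose_loopX, mul_assoc, ← mul_assoc (loopX _),
          loopX_neg_mul, one_mul, conjTranspose_loopZ, loopZ_neg_mul]
    simp only [Matrix.conjTranspose_mul, conjTranspose_loopX, conjTranspose_loopZ, neg_neg,
      ← mul_assoc] at h
    exact ⟨Q, hQ, eqUpToUnitary_of_eq h⟩
  | case4 =>
    obtain ⟨Q, hQ, h⟩ := exists_channel_of_unitaries (p := p) (fun _ => 1) fun k => by simp
    refine ⟨Q, hQ, eqUpToUnitary_of_eq fun ρ => ?_⟩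
    rw [h]
    simp only [one_mul, Matrix.conjTranspose_one, mul_one, Finset.sum_const, Finset.card_univ,
      Fintype.card_prod, ZMod.card, ← sq, id]
    rw [← Nat.cast_smul_eq_nsmul ℂ, smul_smul, Nat.cast_pow, inv_mul_cancel₀ natCast_sq_ne_zero,
      one_smul]

end Existence

/-! ### Counting the classes and assembling the theorem -/

theorem Case.card (p : ℕ) [Fact p.Prime] : Nat.card (Case p) = p + 3 := by
  have hp := (Fact.out : p.Prime).one_le
  let e : Case p ≃ Fin 4 ⊕ (ZMod p)ˣ :=
    { toFun := fun κ => match κ with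
        | .case1 => .inl 0
        | .case2 => .inl 1
        | .case3a => .inl 2
        | .case4 => .inl 3
        | .case3b c => .inr c
      invFun := Sum.elim ![.case1, .case2, .case3a, .case4] .case3b
      left_inv := fun κ => by cases κ <;> rfl
      right_inv := fun x => by
        rcases x with i | c
        · fin_cases i <;> rfl
        · rfl }
  rw [Nat.card_congr e, Nat.card_sum, Nat.card_fin, Nat.card_eq_fintype_card, ZMod.card_units]
  omega

/-- The ensemble with a single syndrome. -/
noncomputable def singleSyndrome {p : ℕ} [NeZero p] {Q : ChoiMatrix p} (hQ : IsChannel Q) :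
    LogicalEnsemble p (Fin 1) where
  prob _ := 1
  prob_pos _ := one_pos
  prob_sum := by simp
  choi _ := Q
  isChannel _ := hQ

theorem exists_case_eq_spt {p n : ℕ} [Fact p.Prime] (hn : 2 ≤ n) {Θ : Type*} [Fintype Θ]
    (E : LogicalEnsemble p Θ) (S : SPTOrder p n) (h : E.expectation n = S.tensor) :
    ∃ κ : Case p, S = κ.spt n := by
  have : NeZero n := ⟨by omega⟩
  obtain ⟨κ, hκ, -⟩ := exists_case_of_expectation E hn S h
  exact ⟨κ, SPTOrder.tensor_injective (hκ.trans (spt_tensor κ).symm)⟩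

theorem spt_injective {p n : ℕ} [Fact p.Prime] (hn : 2 ≤ n) :
    Function.Injective (Case.spt (p := p) n) := by
  have : NeZero n := ⟨by omega⟩
  intro κ κ' h
  exact Case.tensor_injective hn ((spt_tensor κ).symm.trans ((congrArg _ h).trans (spt_tensor κ')))

theorem relations_of_expectation {p n : ℕ} [Fact p.Prime] (hn : 2 ≤ n) {Θ : Type*} [Fintype Θ]
    (E : LogicalEnsemble p Θ) (κ : Case p) (h : E.expectation n = κ.tensor n) (θ : Θ) :
    ∃ F : Loop p → Matrix (Loop p) (Loop p × Loop p) ℂ,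
      (∀ s t, block (E.choi θ) s t = F s * (F t)ᴴ) ∧ κ.Relations fun s => corner (F s) := by
  have : NeZero n := ⟨by omega⟩
  obtain ⟨κ', hκ, hF⟩ := exists_case_of_expectation E hn (κ.spt n) (h.trans (spt_tensor κ).symm)
  obtain rfl := Case.tensor_injective hn ((spt_tensor κ).symm.trans hκ)
  exact hF θ

theorem normalForm_of_relations {p : ℕ} [Fact p.Prime] {Q : ChoiMatrix p} (hQ : IsChannel Q)
    {F : Loop p → Matrix (Loop p) (Loop p × Loop p) ℂ}
    (hF : ∀ s t, block Q s t = F s * (F t)ᴴ) (κ : Case p) (hκ : ∀ c, κ ≠ .case3b c)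
    (h : κ.Relations fun s => corner (F s)) : κ.NormalForm Q := by
  cases κ with
  | case1 => exact normalForm_case1 hF h
  | case2 => exact normalForm_case2 hQ hF h
  | case3a => exact normalForm_case3a hQ hF h
  | case3b c => exact absurd rfl (hκ c)
  | case4 => exact normalForm_case4 hQ hF h

theorem range_spt {p n : ℕ} [Fact p.Prime] (hn : 2 ≤ n) :
    {S : SPTOrder p n | ∃ (m : ℕ) (E : LogicalEnsemble p (Fin m)), E.expectation n = S.tensor} =
      Set.range (Case.spt n) := by
  have : NeZero n := ⟨by omega⟩
  ext S
  refine ⟨fun ⟨m, E, h⟩ => ?_, ?_⟩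
  · obtain ⟨κ, rfl⟩ := exists_case_eq_spt hn E S h
    exact ⟨κ, rfl⟩
  -- A single syndrome whose channel has the normal form already realizes the class.
  · rintro ⟨κ, rfl⟩
    obtain ⟨Q, hQ, h⟩ := exists_channel_normalForm κ
    exact ⟨1, singleSyndrome hQ, (expectation_of_normalForm (singleSyndrome hQ) (by omega) κ
      fun _ => h).trans (spt_tensor κ).symm⟩

end ToricCode

theorem theorem1 (p : ℕ) [Fact p.Prime] (n : ℕ) (hn : 2 ≤ n) :
    -- exactly `p + 3` boundary SPT orders occur
    {S : ToricCode.SPTOrder p n | ∃ (m : ℕ) (E : ToricCode.LogicalEnsemble p (Fin m)),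
        E.expectation n = S.tensor}.ncard = p + 3 ∧
    -- every solution belongs to exactly one of the listed classes
    (∀ (Θ : Type u) [Fintype Θ] (E : ToricCode.LogicalEnsemble p Θ) (S : ToricCode.SPTOrder p n),
      E.expectation n = S.tensor → ∃! κ : ToricCode.Case p, S = κ.spt n) ∧
    -- the expectation tensors of the classes
    (∀ κ : ToricCode.Case p, (κ.spt n).tensor = κ.tensor n) ∧
    -- the code space channels of the solutions in each class
    (∀ (Θ : Type u) [Fintype Θ] (E : ToricCode.LogicalEnsemble p Θ) (κ : ToricCode.Case p),
      E.expectation n = κ.tensor n → ∀ θ : Θ,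
        ((∀ c, κ ≠ .case3b c) → κ.NormalForm (E.choi θ)) ∧
        (∀ c : (ZMod p)ˣ, κ = .case3b c →
          ToricCode.IsOptimallyRecovered (E.choi θ) (ToricCode.dephaseXZ (c : ZMod p)))) ∧
    -- conversely, the channels of each class exist and produce its expectation tensor
    (∀ κ : ToricCode.Case p,
      (∃ Q : ToricCode.ChoiMatrix p, ToricCode.IsChannel Q ∧ κ.NormalForm Q) ∧
      ∀ (Θ : Type u) [Fintype Θ] (E : ToricCode.LogicalEnsemble p Θ),
        (∀ θ : Θ, κ.NormalForm (E.choi θ)) → E.expectation n = κ.tensor n) := by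
  have : NeZero n := ⟨by omega⟩
  refine ⟨?_, fun Θ _ E S h => ?_, ToricCode.spt_tensor, fun Θ _ E κ h θ => ?_, fun κ =>
    ⟨ToricCode.exists_channel_normalForm κ,
      fun Θ _ E h => ToricCode.expectation_of_normalForm E (by omega) κ h⟩⟩
  · rw [ToricCode.range_spt hn, ← Nat.card_coe_set_eq,
      Nat.card_range_of_injective (ToricCode.spt_injective hn), ToricCode.Case.card]
  · obtain ⟨κ, rfl⟩ := ToricCode.exists_case_eq_spt hn E S h
    exact ⟨κ, rfl, fun κ' h' => ToricCode.spt_injective hn h'.symm⟩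
  · obtain ⟨F, hF, hA⟩ := ToricCode.relations_of_expectation hn E κ h θ
    refine ⟨fun hκ => ToricCode.normalForm_of_relations (E.isChannel θ) hF κ hκ hA, ?_⟩
    rintro c rfl
    exact ToricCode.isOptimallyRecovered (E.isChannel θ) hF hA
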